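/- Let $\Delta$ be the open unit disk, $G=PSU(1,1)=SU(1,1)/\{\pm1\}$ acting on $\Delta$ by $z\mapsto\frac{az+b}{\bar bz+\bar a}$, and let $$\tilde G=\Big\{\Big(\begin{pmatrix}a&b\\ \bar b&\bar a\end{pmatrix},A\Big)\in SU(1,1)\times\mathbb C:\ e^A=a\Big\},\qquad A_3=A_1+A_2+\log\Big(1+\frac{b_1\bar b_2}{a_1a_2}\Big)\ \text{ if } \tilde g_3=\tilde g_1\tilde g_2,$$ be its universal covering group. The kernel of $\tilde G\to G$ is the copy of $\mathbb Z$ generated by $(-1,i\pi)$; for a positive integer $N$ put $G^{(N)}=\tilde G/N\mathbb Z$, the $N$-fold covering group of $G$. For real $m$ let $H^m=H^m(\Delta)$ be the space of holomorphic differentials $f(z)(dz)^m$ on $\Delta$, with the topology of uniform convergence on compact sets, its Borel structure, and the action of $\tilde G$ by $$\tilde g:\ f(z)(dz)^m\mapsto f\Big(\frac{\bar az-b}{-\bar bz+a}\Big)(a-\bar bz)^{-2m}(dz)^m,\qquad (a-\bar bz)^{-2m}=e^{-2mA}\Big(1-\frac{\bar b}{a}z\Big)^{-2m}.$$ A lattice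 in a topological group is a discrete subgroup whose quotient has finite nonzero invariant volume. For a group acting on $H^m$ and $\theta\in H^m$, the orbit of $\theta$ is identified with the quotient of the group by the stability subgroup of $\theta$; a measure $\nu$ on $H^m$ is called transitive if, for some $\theta\in H^m$, the orbit $\tilde G_*\theta$ has finite nonzero invariant volume and $\nu$ is the normalized invariant volume of this orbit. Proposition. Let $m>0$ and let $\nu$ be a transitive $\tilde G$-invariant measure on $H^m$. Then either $\nu=\delta_0$, or $m=M/N$ is rational, with coprime positive integers $M,N$ (so that the action on $H^m$ descends to $G^{(N)}$), and there is a nonzero $\theta\in H^m$ such that: 1. $\nu$ is the normalized invariant probability measure on the orbit $G^{(N)}_*\theta$; 2. the stability subgroup $L^{(N)}\subset G^{(N)}$ of $\theta$ is a lattice, the projection $G^{(N)}\to G$ is injective on $L^{(N)}$, and its image $L\subset G$ is a lattice, so that $L\backslash\Delta$ is a Riemann surface (with cone points if $L$ has torsion) of finite area for the Poincaré metric; 3. $\theta$ is the pullback to $\Delta$ of a holomorphic $m$-differential on $L\backslash\Delta$, that is, of a holomorphic section of the $M$-th power $\kappa^{M/N}$ of an $N$-th root $\kappa^{1/N}$ of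 the canonical bundle $\kappa$ of $L\backslash\Delta$, namely the quotient by $L^{(N)}$ of the $G^{(N)}$-equivariant bundle $\kappa^{1/N}$ over $\Delta$. At points of $\Delta$ with nontrivial stabilizer in $L$, bundles and sections are understood in the orbifold sense (quotients of $L$-equivariant objects on $\Delta$; holomorphic means given locally by a holomorphic coefficient function on $\Delta$). -/

import Mathlib

open MeasureTheory Topology
open scoped ComplexConjugate Complex.UnitDisc

noncomputable section

namespace ConformalDisc

/-! ### The group `SU(1,1)` and its action on the unit disc `𝔻` -/

/-- `SU(1,1)`: the matrices `(a, b; conj b, conj a)` of determinant one. -/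
def SU11Subgroup : Subgroup (Matrix.SpecialLinearGroup (Fin 2) ℂ) where
  carrier := {g | g 1 0 = conj (g 0 1) ∧ g 1 1 = conj (g 0 0)}
  one_mem' := by simp
  mul_mem' := by
    rintro g h ⟨hg1, hg2⟩ ⟨hh1, hh2⟩
    simp only [Set.mem_ofPred_eq, Matrix.SpecialLinearGroup.coe_mul, Matrix.mul_apply,
      Fin.sum_univ_two, map_add, map_mul, hg1, hg2, hh1, hh2, Complex.conj_conj]
    constructor <;> ring
  inv_mem' := by
    rintro g ⟨hg1, hg2⟩
    simp only [Set.mem_ofPred_eq, Matrix.SpecialLinearGroup.coe_inv, Matrix.adjugate_fin_two,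
      Matrix.of_apply, Matrix.cons_val', Matrix.cons_val_zero, Matrix.cons_val_one,
      Matrix.cons_val_fin_one, hg1, hg2, map_neg, Complex.conj_conj, and_self]

/-- `SU(1,1)` as a type. -/
abbrev SU11 : Type := SU11Subgroup

namespace SU11

/-- The entry `a` of `(a, b; conj b, conj a)`. -/
def a (g : SU11) : ℂ := g.1 0 0

/-- The entry `b` of `(a, b; conj b, conj a)`. -/
def b (g : SU11) : ℂ := g.1 0 1

theorem det_eq (g : SU11) : g.a * conj g.a - g.b * conj g.b = 1 := by
  have h := g.1.det_coe
  rw [Matrix.det_fin_two, g.2.1, g.2.2] at h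
  exact h

theorem ext' {g h : SU11} (ha : g.a = h.a) (hb : g.b = h.b) : g = h := by
  apply Subtype.ext
  ext i j
  have h1 : g.1 1 0 = h.1 1 0 := by
    rw [g.2.1, h.2.1]; exact congrArg _ hb
  have h2 : g.1 1 1 = h.1 1 1 := by
    rw [g.2.2, h.2.2]; exact congrArg _ ha
  fin_cases i <;> fin_cases j
  exacts [ha, hb, h1, h2]

@[simp] theorem one_a : (1 : SU11).a = 1 := by simp [a]
@[simp] theorem one_b : (1 : SU11).b = 0 := by simp [b]

theorem mul_a (g h : SU11) : (g * h).a = g.a * h.a + g.b * conj h.b := by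
  have := h.2.1
  simp only [a, b, Subgroup.coe_mul, Matrix.SpecialLinearGroup.coe_mul, Matrix.mul_apply,
    Fin.sum_univ_two, this]

theorem mul_b (g h : SU11) : (g * h).b = g.a * h.b + g.b * conj h.a := by
  have := h.2.2
  simp only [a, b, Subgroup.coe_mul, Matrix.SpecialLinearGroup.coe_mul, Matrix.mul_apply,
    Fin.sum_univ_two, this]

@[simp] theorem inv_a (g : SU11) : (g⁻¹).a = conj g.a := by
  have := g.2.2
  simp [a, Matrix.SpecialLinearGroup.coe_inv, Matrix.adjugate_fin_two, this]

@[simp] theorem inv_b (g : SU11) : (g⁻¹).b = -g.b := by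
  simp [b, Matrix.SpecialLinearGroup.coe_inv, Matrix.adjugate_fin_two]

theorem norm_sq_eq (g : SU11) : ‖g.a‖ ^ 2 = 1 + ‖g.b‖ ^ 2 := by
  have h := g.det_eq
  rw [Complex.mul_conj', Complex.mul_conj'] at h
  have h' : (‖g.a‖ ^ 2 - ‖g.b‖ ^ 2 : ℝ) = 1 := by exact_mod_cast h
  linarith

theorem norm_b_lt (g : SU11) : ‖g.b‖ < ‖g.a‖ := by
  have := g.norm_sq_eq
  nlinarith [norm_nonneg g.a, norm_nonneg g.b]

theorem a_ne_zero (g : SU11) : g.a ≠ 0 := by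
  have := g.norm_b_lt
  intro h
  rw [h, norm_zero] at this
  linarith [norm_nonneg g.b]

theorem conj_a_ne_zero (g : SU11) : conj g.a ≠ 0 := by
  simpa using g.a_ne_zero

theorem norm_ratio_mul_lt (g : SU11) {w : ℂ} (hw : ‖w‖ ≤ 1) : ‖conj g.b / g.a * w‖ < 1 := by
  have h0 : 0 < ‖g.a‖ := norm_pos_iff.2 g.a_ne_zero
  have h1 : ‖conj g.b / g.a‖ < 1 := by
    rw [norm_div, Complex.norm_conj, div_lt_one h0]
    exact g.norm_b_lt
  rw [norm_mul]
  nlinarith [norm_nonneg (conj g.b / g.a), norm_nonneg w]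

theorem den_ne_zero (g : SU11) (z : 𝔻) : conj g.b * z + conj g.a ≠ 0 := by
  intro h
  have h1 : ‖conj g.b * (z : ℂ)‖ = ‖conj g.a‖ := by
    rw [eq_neg_of_add_eq_zero_left h, norm_neg]
  rw [norm_mul, Complex.norm_conj, Complex.norm_conj] at h1
  nlinarith [z.norm_lt_one, g.norm_b_lt, norm_nonneg g.b, norm_nonneg (z : ℂ)]

theorem norm_moebius_lt (g : SU11) (z : 𝔻) :
    ‖(g.a * z + g.b) / (conj g.b * z + conj g.a)‖ < 1 := by
  have h0 : 0 < ‖conj g.b * (z : ℂ) + conj g.a‖ := norm_pos_iff.2 (g.den_ne_zero z)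
  rw [norm_div, div_lt_one h0]
  refine lt_of_pow_lt_pow_left₀ 2 h0.le ?_
  have key : ‖conj g.b * (z : ℂ) + conj g.a‖ ^ 2 - ‖g.a * z + g.b‖ ^ 2 = 1 - ‖(z : ℂ)‖ ^ 2 := by
    have h : ((‖conj g.b * (z : ℂ) + conj g.a‖ ^ 2 - ‖g.a * z + g.b‖ ^ 2 : ℝ) : ℂ)
        = ((1 - ‖(z : ℂ)‖ ^ 2 : ℝ) : ℂ) := by
      push_cast
      simp only [← Complex.mul_conj', map_add, map_mul, Complex.conj_conj]
      linear_combination (1 - (z : ℂ) * conj (z : ℂ)) * g.det_eq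
    exact_mod_cast h
  have := z.sq_norm_lt_one
  linarith

/-- The linear fractional action `z ↦ (a z + b) / (conj b z + conj a)` on the disc. -/
instance : MulAction SU11 𝔻 where
  smul g z := Complex.UnitDisc.mk ((g.a * z + g.b) / (conj g.b * z + conj g.a))
    (g.norm_moebius_lt z)
  one_smul z := by
    apply Complex.UnitDisc.coe_injective
    change ((1 : SU11).a * z + (1 : SU11).b) / (conj (1 : SU11).b * z + conj (1 : SU11).a) = (z : ℂ)
    simp
  mul_smul g h z := by
    apply Complex.UnitDisc.coe_injective
    change ((g * h).a * z + (g * h).b) / (conj (g * h).b * z + conj (g * h).a)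
      = (g.a * ((h.a * z + h.b) / (conj h.b * z + conj h.a)) + g.b)
        / (conj g.b * ((h.a * z + h.b) / (conj h.b * z + conj h.a)) + conj g.a)
    have hh := h.den_ne_zero z
    rw [mul_a, mul_b]
    simp only [map_add, map_mul, Complex.conj_conj]
    rw [mul_div_assoc', mul_div_assoc', div_add' _ _ _ hh, div_add' _ _ _ hh,
      div_div_div_cancel_right₀ hh]
    congr 1 <;> ring

theorem coe_smul (g : SU11) (z : 𝔻) :
    ((g • z : 𝔻) : ℂ) = (g.a * z + g.b) / (conj g.b * z + conj g.a) := rfl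

theorem continuous_smul (g : SU11) : Continuous (fun z : 𝔻 => g • z) := by
  rw [Complex.UnitDisc.isEmbedding_coe.continuous_iff]
  have h : Continuous fun z : 𝔻 => (g.a * (z : ℂ) + g.b) / (conj g.b * z + conj g.a) :=
    Continuous.div (by fun_prop) (by fun_prop) (g.den_ne_zero)
  exact h

/-- The matrix `-1`. -/
def negOne : SU11 := ⟨-1, by simp [SU11Subgroup]⟩

@[simp] theorem negOne_a : negOne.a = -1 := by simp [negOne, a]
@[simp] theorem negOne_b : negOne.b = 0 := by simp [negOne, b]

theorem negOne_comm (g : SU11) : negOne * g = g * negOne := by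
  apply ext' <;> simp [mul_a, mul_b]

theorem negOne_smul (z : 𝔻) : negOne • z = z := by
  apply Complex.UnitDisc.coe_injective
  rw [coe_smul]; simp

instance : (Subgroup.zpowers negOne).Normal where
  conj_mem n hn g := by
    have hc : Commute negOne g := negOne_comm g
    obtain ⟨k, rfl⟩ := Subgroup.mem_zpowers_iff.1 hn
    rw [← (hc.zpow_left k).eq, mul_assoc, mul_inv_cancel, mul_one]
    exact hn

end SU11

/-- `G = PSU(1,1) = SU(1,1) / {±1}`. -/
abbrev PSU11 : Type := SU11 ⧸ Subgroup.zpowers SU11.negOne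

/-- The action of `PSU(1,1)` on the disc as a homomorphism into the permutations. -/
def PSU11.toPerm : PSU11 →* Equiv.Perm 𝔻 :=
  QuotientGroup.lift _ (MulAction.toPermHom SU11 𝔻) <| by
    rw [Subgroup.zpowers_le]
    rw [MonoidHom.mem_ker]
    ext z : 1
    exact SU11.negOne_smul z

instance : MulAction PSU11 𝔻 := MulAction.compHom 𝔻 PSU11.toPerm

theorem PSU11.mk_smul (g : SU11) (z : 𝔻) : (QuotientGroup.mk g : PSU11) • z = g • z := rfl

/-! ### The universal covering group of `PSU(1,1)` -/

theorem eq_of_exp_eq {x y : ℂ} (h : Complex.exp x = Complex.exp y)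
    (him : |x.im - y.im| < 2 * Real.pi) : x = y := by
  obtain ⟨n, hn⟩ := Complex.exp_eq_exp_iff_exists_int.1 h
  have h1 : x.im - y.im = n * (2 * Real.pi) := by
    rw [hn]; simp
  have hpi := Real.pi_pos
  rw [h1, abs_mul, abs_of_pos (by linarith : (0 : ℝ) < 2 * Real.pi)] at him
  have h2 : |(n : ℝ)| < 1 := by
    by_contra h3
    push Not at h3
    nlinarith
  have h4 : n = 0 := by
    have : |n| < 1 := by exact_mod_cast h2
    exact Int.abs_lt_one_iff.1 this
  rw [hn, h4]; simp

theorem re_one_add_pos {w : ℂ} (hw : ‖w‖ < 1) : 0 < (1 + w).re := by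
  have := Complex.abs_re_le_norm w
  have := abs_le.1 this
  simp only [Complex.add_re, Complex.one_re]
  linarith

theorem one_add_ne_zero {w : ℂ} (hw : ‖w‖ < 1) : 1 + w ≠ 0 := by
  intro h
  have := re_one_add_pos hw
  rw [h] at this
  simp at this

theorem abs_im_log_lt {w : ℂ} (hw : ‖w‖ < 1) : |(Complex.log (1 + w)).im| < Real.pi / 2 := by
  rw [Complex.log_im, Complex.abs_arg_lt_pi_div_two_iff]
  exact Or.inl (re_one_add_pos hw)

/-- The universal covering group of `PSU(1,1)`, in the model of pairs `(g, A)` in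
`SU(1,1) × ℂ` with `exp A = a`. -/
def GTilde : Type := {x : SU11 × ℂ // Complex.exp x.2 = x.1.a}

namespace GTilde

instance : TopologicalSpace GTilde :=
  inferInstanceAs (TopologicalSpace {x : SU11 × ℂ // Complex.exp x.2 = x.1.a})

/-- The matrix of an element of the covering group. -/
def mat (g : GTilde) : SU11 := g.1.1

/-- The chosen logarithm `A` of the entry `a`. -/
def A (g : GTilde) : ℂ := g.1.2

theorem exp_A (g : GTilde) : Complex.exp g.A = g.mat.a := g.2

theorem ext' {g h : GTilde} (h1 : g.mat = h.mat) (h2 : g.A = h.A) : g = h :=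
  Subtype.ext (Prod.ext h1 h2)

theorem norm_mul_term_lt (g h : SU11) : ‖g.b * conj h.b / (g.a * h.a)‖ < 1 := by
  have h1 : ‖g.b * conj h.b / (g.a * h.a)‖ = ‖conj g.b / g.a * (conj h.b / h.a)‖ := by
    simp only [norm_div, norm_mul, Complex.norm_conj]
    ring
  rw [h1]
  refine g.norm_ratio_mul_lt ?_
  simpa using (h.norm_ratio_mul_lt (w := 1) (by simp)).le

/-- `(g, A) (h, B) = (g h, A + B + log (1 + b_g conj b_h / (a_g a_h)))`. -/
instance : Mul GTilde where
  mul g h := ⟨(g.mat * h.mat,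
      g.A + h.A + Complex.log (1 + g.mat.b * conj h.mat.b / (g.mat.a * h.mat.a))), by
    have h1 := g.mat.a_ne_zero
    have h2 := h.mat.a_ne_zero
    rw [Complex.exp_add, Complex.exp_add, exp_A, exp_A,
      Complex.exp_log (one_add_ne_zero (norm_mul_term_lt _ _)), SU11.mul_a]
    field_simp⟩

instance : One GTilde where
  one := ⟨(1, 0), by simp⟩

instance : Inv GTilde where
  inv g := ⟨(g.mat⁻¹, conj g.A), by
    rw [SU11.inv_a, ← exp_A, Complex.exp_conj]⟩

@[simp] theorem mat_mul (g h : GTilde) : (g * h).mat = g.mat * h.mat := rfl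
@[simp] theorem mat_one : (1 : GTilde).mat = 1 := rfl
@[simp] theorem mat_inv (g : GTilde) : (g⁻¹).mat = g.mat⁻¹ := rfl
theorem A_mul (g h : GTilde) : (g * h).A =
    g.A + h.A + Complex.log (1 + g.mat.b * conj h.mat.b / (g.mat.a * h.mat.a)) := rfl
@[simp] theorem A_one : (1 : GTilde).A = 0 := rfl
@[simp] theorem A_inv (g : GTilde) : (g⁻¹).A = conj g.A := rfl

instance : Group GTilde :=
  Group.ofLeftAxioms
    (by
      intro x y z
      have hm : (x * y * z).mat = (x * (y * z)).mat := by simp [mul_assoc]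
      refine ext' hm (eq_of_exp_eq (by rw [exp_A, exp_A, hm]) ?_)
      rw [A_mul, A_mul, A_mul x, A_mul y]
      have h1 := abs_lt.1 (abs_im_log_lt (norm_mul_term_lt x.mat y.mat))
      have h2 := abs_lt.1 (abs_im_log_lt (norm_mul_term_lt (x * y).mat z.mat))
      have h3 := abs_lt.1 (abs_im_log_lt (norm_mul_term_lt y.mat z.mat))
      have h4 := abs_lt.1 (abs_im_log_lt (norm_mul_term_lt x.mat (y * z).mat))
      simp only [Complex.add_im]
      rw [abs_lt]
      constructor <;> linarith [h1.1, h1.2, h2.1, h2.2, h3.1, h3.2, h4.1, h4.2])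
    (by
      intro x
      refine ext' (by simp) ?_
      rw [A_mul]; simp)
    (by
      intro x
      have hm : (x⁻¹ * x).mat = (1 : GTilde).mat := by simp
      refine ext' hm (eq_of_exp_eq (by rw [exp_A, exp_A, hm]) ?_)
      rw [A_mul]
      have h1 := abs_lt.1 (abs_im_log_lt (norm_mul_term_lt (x⁻¹).mat x.mat))
      simp only [Complex.add_im, A_inv, Complex.conj_im, A_one, Complex.zero_im]
      have := Real.pi_pos
      rw [abs_lt]
      constructor <;> linarith [h1.1, h1.2])

/-- The projection of the covering group to `SU(1,1)`. -/
def toSU : GTilde →* SU11 where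
  toFun := mat
  map_one' := rfl
  map_mul' _ _ := rfl

/-- The universal covering projection onto `PSU(1,1)`. -/
def toPSU : GTilde →* PSU11 := (QuotientGroup.mk' _).comp toSU

/-- `logDen g z = A + log (1 - (conj b / a) z)`, the branch of `log (a - conj b z)` determined
by `g = ((a, b; conj b, conj a), A)`. -/
def logDen (g : GTilde) (z : ℂ) : ℂ := g.A + Complex.log (1 - conj g.mat.b / g.mat.a * z)

theorem norm_log_term_lt (g : GTilde) (z : 𝔻) : ‖-(conj g.mat.b / g.mat.a * (z : ℂ))‖ < 1 := by
  rw [norm_neg]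
  exact g.mat.norm_ratio_mul_lt z.norm_lt_one.le

theorem exp_logDen (g : GTilde) (z : 𝔻) :
    Complex.exp (g.logDen z) = g.mat.a - conj g.mat.b * z := by
  have h1 := g.mat.a_ne_zero
  rw [logDen, sub_eq_add_neg, Complex.exp_add, exp_A,
    Complex.exp_log (one_add_ne_zero (g.norm_log_term_lt z))]
  field_simp
  ring

theorem logDen_one (z : 𝔻) : (1 : GTilde).logDen z = 0 := by simp [logDen]

theorem logDen_mul (g h : GTilde) (z : 𝔻) :
    (g * h).logDen z = g.logDen z + h.logDen ((g.mat⁻¹ • z : 𝔻) : ℂ) := by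
  refine eq_of_exp_eq ?_ ?_
  · have hd := (g.mat⁻¹).den_ne_zero z
    rw [Complex.exp_add, exp_logDen, exp_logDen, exp_logDen, SU11.coe_smul]
    simp only [SU11.inv_a, SU11.inv_b, map_neg, Complex.conj_conj, mat_mul, SU11.mul_a,
      SU11.mul_b, map_add, map_mul] at hd ⊢
    have h1 : (g.mat.a - conj g.mat.b * (z : ℂ)) *
        ((conj g.mat.a * (z : ℂ) + -g.mat.b) / (-conj g.mat.b * z + g.mat.a))
        = conj g.mat.a * (z : ℂ) + -g.mat.b := by
      rw [neg_mul, neg_add_eq_sub] at hd ⊢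
      exact mul_div_cancel₀ _ hd
    linear_combination conj h.mat.b * h1
  · have h1 := abs_lt.1 (abs_im_log_lt (norm_log_term_lt (g * h) z))
    have h2 := abs_lt.1 (abs_im_log_lt (norm_log_term_lt g z))
    have h3 := abs_lt.1 (abs_im_log_lt (norm_log_term_lt h (g.mat⁻¹ • z)))
    have h4 := abs_lt.1 (abs_im_log_lt (norm_mul_term_lt g.mat h.mat))
    simp only [logDen, A_mul, Complex.add_im, sub_eq_add_neg]
    rw [abs_lt]
    constructor <;> linarith [h1.1, h1.2, h2.1, h2.2, h3.1, h3.2, h4.1, h4.2]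

/-- The generator `(-1, iπ)` of the kernel `ℤ` of the covering of `PSU(1,1)`. -/
def center : GTilde := ⟨(SU11.negOne, Complex.I * Real.pi), by
  rw [mul_comm, Complex.exp_pi_mul_I, SU11.negOne_a]⟩

@[simp] theorem mat_center : center.mat = SU11.negOne := rfl
@[simp] theorem A_center : center.A = Complex.I * Real.pi := rfl

theorem center_comm (g : GTilde) : Commute center g := by
  refine ext' (SU11.negOne_comm g.mat) ?_
  rw [A_mul, A_mul]
  simp [add_comm]

instance (N : ℕ) : (Subgroup.zpowers (center ^ N)).Normal where
  conj_mem n hn g := by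
    have hc : Commute (center ^ N) g := (center_comm g).pow_left N
    obtain ⟨k, rfl⟩ := Subgroup.mem_zpowers_iff.1 hn
    rw [← (hc.zpow_left k).eq, mul_assoc, mul_inv_cancel, mul_one]
    exact hn

end GTilde

/-- The `N`-fold covering group `G^(N)` of `G = PSU(1,1)`: the quotient of the universal covering
group by the subgroup `N ℤ` of the kernel `ℤ` of the covering of `G`. -/
abbrev GCover (N : ℕ) : Type := GTilde ⧸ Subgroup.zpowers (GTilde.center ^ N)

/-- The covering projection `G^(N) → G`. -/
def GCover.toPSU (N : ℕ) : GCover N →* PSU11 :=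
  QuotientGroup.lift _ GTilde.toPSU <| by
    rw [Subgroup.zpowers_le, MonoidHom.mem_ker, map_pow]
    have h : GTilde.toPSU GTilde.center = 1 :=
      (QuotientGroup.eq_one_iff (N := Subgroup.zpowers SU11.negOne) SU11.negOne).2
        (Subgroup.mem_zpowers _)
    rw [h, one_pow]

/-! ### The space of holomorphic differentials and the action -/

/-- The space `H^m` of holomorphic differentials `f(z) (dz)^m` on the disc, where a differential
is identified with its coefficient `f`. As a topological vector space (with the topology of
uniform convergence on compact sets) it does not depend on `m`, only the action does. -/
def Hol : Submodule ℂ C(𝔻, ℂ) where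
  carrier := {f | ∃ F : ℂ → ℂ, DifferentiableOn ℂ F (Metric.ball 0 1) ∧ ∀ z : 𝔻, f z = F z}
  zero_mem' := ⟨fun _ => 0, differentiableOn_const _, fun _ => rfl⟩
  add_mem' := by
    rintro f g ⟨F, hF, hf⟩ ⟨K, hK, hg⟩
    exact ⟨fun z => F z + K z, hF.add hK, fun z => by simp [hf, hg]⟩
  smul_mem' := by
    rintro c f ⟨F, hF, hf⟩
    exact ⟨fun z => c * F z, hF.const_mul c, fun z => by simp [hf]⟩

instance : MeasurableSpace Hol := borel Hol

instance : BorelSpace Hol := ⟨rfl⟩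

theorem differentiableOn_logDen (g : GTilde) :
    DifferentiableOn ℂ g.logDen (Metric.ball 0 1) := by
  intro z hz
  have hz' : ‖z‖ < 1 := mem_ball_zero_iff.1 hz
  have h := g.norm_log_term_lt (Complex.UnitDisc.mk z hz')
  have h2 : 1 - conj g.mat.b / g.mat.a * z ∈ Complex.slitPlane := by
    rw [sub_eq_add_neg]
    exact Or.inl (re_one_add_pos h)
  refine DifferentiableAt.differentiableWithinAt ?_
  unfold GTilde.logDen
  have h3 : DifferentiableAt ℂ (fun w : ℂ => 1 - conj g.mat.b / g.mat.a * w) z := by fun_prop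
  exact (h3.clog h2).const_add _

/-- The coefficient of the transformed differential:
`f(g⁻¹ z) (a - conj b z)^(-2m)`, the power being `exp (-2m (A + log (1 - (conj b / a) z)))`. -/
def actFun (m : ℝ) (g : GTilde) (f : 𝔻 → ℂ) (z : 𝔻) : ℂ :=
  f (g.mat⁻¹ • z) * Complex.exp (-2 * m * g.logDen z)

theorem actFun_one (m : ℝ) (f : 𝔻 → ℂ) : actFun m 1 f = f := by
  funext z
  simp [actFun, GTilde.logDen_one]

theorem actFun_mul (m : ℝ) (g h : GTilde) (f : 𝔻 → ℂ) :
    actFun m (g * h) f = actFun m g (actFun m h f) := by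
  funext z
  simp only [actFun, GTilde.mat_mul, GTilde.logDen_mul, mul_inv_rev, mul_smul, mul_add,
    Complex.exp_add]
  ring

theorem continuous_logDen (g : GTilde) : Continuous fun z : 𝔻 => g.logDen z :=
  (differentiableOn_logDen g).continuousOn.comp_continuous Complex.UnitDisc.continuous_coe
    (fun z => mem_ball_zero_iff.2 z.norm_lt_one)

/-- The transformed differential as an element of `H^m`. -/
def act (m : ℝ) (g : GTilde) (f : Hol) : Hol :=
  ⟨⟨actFun m g f.1, by
      have h1 := SU11.continuous_smul g.mat⁻¹
      have h2 := continuous_logDen g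
      have h3 := f.1.continuous
      unfold actFun
      fun_prop⟩, by
    obtain ⟨F, hF, hf⟩ := f.2
    refine ⟨fun z => F ((conj g.mat.a * z - g.mat.b) / (-conj g.mat.b * z + g.mat.a))
      * Complex.exp (-2 * m * g.logDen z), ?_, ?_⟩
    · refine DifferentiableOn.mul ?_ ?_
      · refine hF.comp ?_ ?_
        · refine DifferentiableOn.div (by fun_prop) (by fun_prop) ?_
          intro z hz
          have := (g.mat⁻¹).den_ne_zero (Complex.UnitDisc.mk z (mem_ball_zero_iff.1 hz))
          simpa using this
        · intro z hz
          have := (g.mat⁻¹).norm_moebius_lt (Complex.UnitDisc.mk z (mem_ball_zero_iff.1 hz))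
          rw [mem_ball_zero_iff]
          simpa [sub_eq_add_neg] using this
      · exact ((differentiableOn_logDen g).const_mul _).cexp
    · intro z
      change f.1 (g.mat⁻¹ • z) * _ = _
      rw [hf, SU11.coe_smul]
      simp [sub_eq_add_neg]⟩

theorem act_apply (m : ℝ) (g : GTilde) (f : Hol) (z : 𝔻) :
    (act m g f).1 z = actFun m g f.1 z := rfl

/-- The action of the universal covering group on `H^m`. -/
def rho (m : ℝ) : GTilde →* Equiv.Perm Hol :=
  letI : MulAction GTilde Hol :=
    { smul := act m
      one_smul := fun f => Subtype.ext (ContinuousMap.ext fun z => congrFun (actFun_one m f.1) z)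
      mul_smul := fun g h f =>
        Subtype.ext (ContinuousMap.ext fun z => congrFun (actFun_mul m g h f.1) z) }
  MulAction.toPermHom GTilde Hol

theorem rho_apply (m : ℝ) (g : GTilde) (f : Hol) : rho m g f = act m g f := rfl

theorem rho_center_pow (m : ℝ) (n : ℕ) (f : Hol) (z : 𝔻) :
    (rho m (GTilde.center ^ n) f).1 z
      = Complex.exp (n * (-2 * m * (Complex.I * Real.pi))) * f.1 z := by
  induction n generalizing f with
  | zero => simp
  | succ k ih =>
    have h1 : ∀ w : 𝔻, (rho m GTilde.center f).1 w
        = f.1 w * Complex.exp (-2 * m * (Complex.I * Real.pi)) := by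
      intro w
      have h2 : (SU11.negOne)⁻¹ • w = w := by
        rw [inv_smul_eq_iff, SU11.negOne_smul]
      rw [rho_apply, act_apply]
      simp [actFun, GTilde.logDen, h2]
    rw [pow_succ, map_mul, Equiv.Perm.mul_apply, ih, h1]
    push_cast
    rw [add_mul, one_mul, Complex.exp_add]
    ring

/-- For `m = M / N` the action on `H^m` descends to `G^(N)`. -/
def rhoCover (M N : ℕ) : GCover N →* Equiv.Perm Hol :=
  QuotientGroup.lift _ (rho ((M : ℝ) / N)) <| by
    rw [Subgroup.zpowers_le, MonoidHom.mem_ker]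
    refine Equiv.ext fun f => Subtype.ext (ContinuousMap.ext fun z => ?_)
    rw [rho_center_pow]
    rcases Nat.eq_zero_or_pos N with rfl | hN
    · simp
    · have hN' : (N : ℂ) ≠ 0 := by exact_mod_cast hN.ne'
      have h : (N : ℂ) * (-2 * (((M : ℝ) / N : ℝ) : ℂ) * (Complex.I * Real.pi))
          = ((-M : ℤ) : ℂ) * (2 * Real.pi * Complex.I) := by
        push_cast
        field_simp
      rw [h, Complex.exp_int_mul_two_pi_mul_I, one_mul]
      rfl

/-! ### Invariant measures on orbits, lattices -/

section Orbits

variable {Γ X : Type*} [Group Γ] [TopologicalSpace Γ]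

/-- `μ` is a `Γ`-invariant Borel measure on the homogeneous space `Γ ⧸ H`. -/
def IsInvariantOn (H : Subgroup Γ) (μ : @Measure (Γ ⧸ H) (borel (Γ ⧸ H))) : Prop :=
  letI : MeasurableSpace (Γ ⧸ H) := borel (Γ ⧸ H)
  SMulInvariantMeasure Γ (Γ ⧸ H) μ

/-- A lattice: a discrete subgroup such that the quotient has finite invariant volume. -/
def IsLattice (H : Subgroup Γ) : Prop :=
  DiscreteTopology H ∧
    ∃ μ : @Measure (Γ ⧸ H) (borel (Γ ⧸ H)),
      IsInvariantOn H μ ∧ μ Set.univ ≠ 0 ∧ μ Set.univ ≠ ⊤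

/-- The stability subgroup of `θ` under an action `ρ`. -/
def stab (ρ : Γ →* Equiv.Perm X) (θ : X) : Subgroup Γ :=
  (MulAction.stabilizer (Equiv.Perm X) θ).comap ρ

/-- The bijection of `Γ ⧸ stab θ` onto the orbit of `θ`, `g ↦ g θ`. -/
def orbitMap (ρ : Γ →* Equiv.Perm X) (θ : X) : Γ ⧸ stab ρ θ → X :=
  fun x => Quotient.liftOn' x (fun g => ρ g θ) <| by
    intro g h hgh
    have h1 : g⁻¹ * h ∈ stab ρ θ := QuotientGroup.leftRel_apply.1 hgh
    have h2 : ρ (g⁻¹ * h) θ = θ := h1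
    rw [map_mul, map_inv, Equiv.Perm.mul_apply, Equiv.Perm.inv_eq_iff_eq] at h2
    exact h2.symm

/-- The orbit of `θ` has finite (nonzero) invariant volume, and `ν` is the normalized invariant
volume of the orbit. The orbit is regarded as the homogeneous space `Γ ⧸ stab θ`. -/
def IsNormalizedOrbitVolume [MeasurableSpace X] (ρ : Γ →* Equiv.Perm X) (θ : X)
    (ν : Measure X) : Prop :=
  letI : MeasurableSpace (Γ ⧸ stab ρ θ) := borel (Γ ⧸ stab ρ θ)
  ∃ μ : Measure (Γ ⧸ stab ρ θ), IsInvariantOn (stab ρ θ) μ ∧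
    μ Set.univ ≠ 0 ∧ μ Set.univ ≠ ⊤ ∧ ν = (μ Set.univ)⁻¹ • μ.map (orbitMap ρ θ)

end Orbits

/-- A transitive measure on `H^m`: the normalized invariant volume of an orbit of finite volume
of the universal covering group. -/
def IsTransitiveMeasure (m : ℝ) (ν : Measure Hol) : Prop :=
  ∃ θ : Hol, IsNormalizedOrbitVolume (rho m) θ ν

/-! ### Differentials on the Riemann surface `L \ 𝔻` -/

/-- The Riemann surface (with cone points where `L` has torsion) `L \ 𝔻`. -/
abbrev Surface (L : Subgroup PSU11) : Type := MulAction.orbitRel.Quotient L 𝔻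

/-- `L \ 𝔻` has finite area for the area element `dx dy / (1 - |z|^2)^2` of the Poincare metric:
some Borel set of finite area meets all orbits of `L`. -/
def Surface.HasFiniteArea (L : Subgroup PSU11) : Prop :=
  ∃ D : Set ℂ, MeasurableSet D ∧ D ⊆ Metric.ball 0 1 ∧
    (∀ z : 𝔻, ∃ g ∈ L, ((g • z : 𝔻) : ℂ) ∈ D) ∧
    ∫⁻ z in D, ENNReal.ofReal (1 / (1 - ‖z‖ ^ 2) ^ 2) < ⊤

/-- The linear fractional map of `g`, as a function on `ℂ` (zero off the disc). -/
def moebius (g : PSU11) (z : ℂ) : ℂ :=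
  if h : ‖z‖ < 1 then ((g • Complex.UnitDisc.mk z h : 𝔻) : ℂ) else 0

/-- An `N`-th root `κ^(1/N)` of the canonical bundle `κ` of `L \ 𝔻`. The canonical bundle is the
quotient of `𝔻 × ℂ` (a point `(z, v)` being the covector `v dz` at `z`) by
`(z, v) ~ (g z, (g' z)⁻¹ v)` for `g ∈ L`. An `N`-th root is the quotient of `𝔻 × ℂ` (a point
being `v (dz)^(1/N)` at `z`) by `(z, v) ~ (g z, factor g z * v)`, where `factor` is a holomorphic
cocycle whose `N`-th power is `(g' z)⁻¹`. -/
structure CanonicalRoot (L : Subgroup PSU11) (N : ℕ) where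
  factor : L → 𝔻 → ℂ
  factor_one : ∀ z, factor 1 z = 1
  factor_mul : ∀ (g h : L) (z : 𝔻), factor (g * h) z = factor g (h • z) * factor h z
  holomorphic : ∀ g : L, ∃ F : ℂ → ℂ, DifferentiableOn ℂ F (Metric.ball 0 1) ∧
    ∀ z : 𝔻, factor g z = F z
  factor_pow : ∀ (g : L) (z : 𝔻), factor g z ^ N = (deriv (moebius g) z)⁻¹

namespace CanonicalRoot

variable {L : Subgroup PSU11} {N : ℕ} (κ : CanonicalRoot L N) (M : ℕ)

/-- The identifications defining the `M`-th tensor power of `κ^(1/N)`. -/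
def setoid : Setoid (𝔻 × ℂ) where
  r p q := ∃ g : L, q = (g • p.1, κ.factor g p.1 ^ M * p.2)
  iseqv :=
    { refl := fun p => ⟨1, by simp [κ.factor_one]⟩
      symm := by
        rintro p q ⟨g, rfl⟩
        refine ⟨g⁻¹, ?_⟩
        have h := κ.factor_mul g⁻¹ g p.1
        rw [inv_mul_cancel, κ.factor_one] at h
        refine Prod.ext (by simp) ?_
        change p.2 = κ.factor g⁻¹ (g • p.1) ^ M * (κ.factor g p.1 ^ M * p.2)
        rw [← mul_assoc, ← mul_pow, ← h, one_pow, one_mul]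
      trans := by
        rintro p q r ⟨g, rfl⟩ ⟨h, rfl⟩
        refine ⟨h * g, Prod.ext (by simp [mul_smul]) ?_⟩
        change κ.factor h (g • p.1) ^ M * (κ.factor g p.1 ^ M * p.2) = _
        rw [κ.factor_mul, mul_pow, mul_assoc] }

/-- The total space of the `M`-th tensor power `κ^(M/N)` of `κ^(1/N)`. -/
def Total : Type := Quotient (κ.setoid M)

/-- The class of the vector `v (dz)^(M/N)` at `z`. -/
def vec (z : 𝔻) (v : ℂ) : κ.Total M := Quotient.mk (κ.setoid M) (z, v)

/-- The bundle projection `κ^(M/N) → L \ 𝔻`. -/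
def proj : κ.Total M → Surface L :=
  Quotient.lift (fun p : 𝔻 × ℂ => (Quotient.mk (MulAction.orbitRel L 𝔻) p.1 : Surface L)) <| by
    rintro p q ⟨g, rfl⟩
    exact (Quotient.sound ⟨g, rfl⟩ : Quotient.mk (MulAction.orbitRel L 𝔻) (g • p.1) = _).symm

/-- A holomorphic differential of degree `M/N` on `L \ 𝔻`: a section of `κ^(M/N)` which lifts
locally to a holomorphic coefficient function on the disc. -/
structure Differential where
  toFun : Surface L → κ.Total M
  isSection : ∀ x, κ.proj M (toFun x) = x
  holomorphic : ∀ z₀ : 𝔻, ∃ U : Set ℂ, IsOpen U ∧ (z₀ : ℂ) ∈ U ∧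
    ∃ u : ℂ → ℂ, DifferentiableOn ℂ u U ∧ ∀ z : 𝔻, (z : ℂ) ∈ U →
      toFun (Quotient.mk (MulAction.orbitRel L 𝔻) z) = κ.vec M z (u z)

variable {κ M}

/-- `θ = f(z) (dz)^(M/N)` is the pullback of the differential `s` along `𝔻 → L \ 𝔻`. -/
def Differential.IsPullback (s : κ.Differential M) (θ : Hol) : Prop :=
  ∀ z : 𝔻, s.toFun (Quotient.mk (MulAction.orbitRel L 𝔻) z) = κ.vec M z (θ.1 z)

/-- The root `κ^(1/N)` is the quotient of the bundle `κ^(1/N)` over the disc by the action of the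
subgroup `LN` of `G^(N)`, which lies over `L`: an element `g = ((a, b; conj b, conj a), A)` of
the universal covering group maps `v (dz)^(1/N)` at `z` to `(conj b z + conj a)^(2/N) v (dz)^(1/N)`
at `g z`, where `(g⁻¹).logDen z = conj A + log (1 + (conj b / conj a) z)` is the branch of
`log (conj b z + conj a)` that defines the power. -/
def IsInducedBy (κ : CanonicalRoot L N) (LN : Subgroup (GCover N)) : Prop :=
  ∀ (l : L) (g : GTilde), (QuotientGroup.mk g : GCover N) ∈ LN → g.toPSU = l →
    ∀ z : 𝔻, κ.factor l z = Complex.exp (2 / N * (g⁻¹).logDen z)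

end CanonicalRoot

end ConformalDisc

end

open MeasureTheory Topology
open scoped ComplexConjugate Complex.UnitDisc

noncomputable section

namespace ConformalDisc

/-! ### Topology of the groups -/

namespace SU11

/-! Let `θ ≠ 0` have an orbit of finite invariant volume, with stability subgroup `S` in the
universal covering group. Two facts drive the proof: Poincaré recurrence on the quotient by `S`
(`exists_translates_meet`), and the invariance under `S` of the real function `h = |θ|² (1 -
|z|²)^(2m)` on the disc (`mat_mem_symmetryGroup`), which is nonconstant for `m > 0` by the maximum
principle for `1/θ` (`hyperbolicNormSq_not_const`).

Discreteness. Recurrence along hyperbolic one-parameter subgroups shows that the symmetry group of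
`h` accumulates projectively at every boundary point of the disc
(`accumulatesAtBoundary_of_isInvariantOn`), a hands-on substitute for Borel density. If the
symmetries were not discrete, a limit of difference quotients would give a nonzero Killing field
annihilating `h`. Moving this field by symmetries that run to the boundary and rescaling gives
parabolic fields that annihilate `h`, and three of them span the tangent plane at each point. So `h`
would be constant (`exists_nhds_inter_symmetryGroup`).

Rationality. Recurrence along the powers of the central generator, combined with discreteness, puts
a positive power of it into `S` (`exists_center_pow_mem`). That power acts by the scalar `exp(-2πi n
m)`, hence `n m` is an integer and `m = M/N`. By coprimality the centre meets `S` only in powers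
divisible by `N`. This gives injectivity of the projection on the stabilizer in the `N`-fold cover,
and it makes the factors `exp((2/N) log(conj b z + conj a))` a well-defined cocycle on `L`, for
which `θ` is equivariant (`apply_smul_eq`).

Finite area. The finite measure is pushed to a quotient of `SU(1,1)` by a discrete group and
unfolded to a Haar measure (`isHaarMeasure_unfoldMeasure`). Unimodularity and Fubini compare Haar
measure with hyperbolic area (`hyperbolicArea_mul_haar`), and a Borel transversal then has finite
area (`hasFiniteArea_of_finite_volume`). -/

theorem continuous_a : Continuous a :=
  (continuous_id.matrix_elem 0 0).comp (continuous_subtype_val.comp continuous_subtype_val)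

theorem continuous_b : Continuous b :=
  (continuous_id.matrix_elem 0 1).comp (continuous_subtype_val.comp continuous_subtype_val)

/-- The element of `SU(1,1)` with given first row. -/
def ofRow (a b : ℂ) (h : a * conj a - b * conj b = 1) : SU11 :=
  ⟨⟨!![a, b; conj b, conj a], by rw [Matrix.det_fin_two]; simpa using h⟩, 
    ⟨by simp, by simp⟩⟩

@[simp] theorem ofRow_a (a b : ℂ) (h) : (ofRow a b h).a = a := by simp [ofRow, SU11.a]
@[simp] theorem ofRow_b (a b : ℂ) (h) : (ofRow a b h).b = b := by simp [ofRow, SU11.b]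

theorem continuous_iff {Y : Type*} [TopologicalSpace Y] {f : Y → SU11} :
    Continuous f ↔ Continuous (fun y => (f y).a) ∧ Continuous (fun y => (f y).b) := by
  refine ⟨fun h => ⟨continuous_a.comp h, continuous_b.comp h⟩, fun ⟨ha, hb⟩ => ?_⟩
  refine Continuous.subtype_mk (Continuous.subtype_mk (continuous_matrix fun i j => ?_) _) _
  fin_cases i <;> fin_cases j
  · exact ha
  · exact hb
  · have h : ∀ y, (f y).1 1 0 = conj (f y).b := fun y => (f y).2.1
    exact (Complex.continuous_conj.comp hb).congr fun y => (h y).symm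
  · have h : ∀ y, (f y).1 1 1 = conj (f y).a := fun y => (f y).2.2
    exact (Complex.continuous_conj.comp ha).congr fun y => (h y).symm

/-- The first row determines the matrix and ranges over the closed quadric `|a|² - |b|² = 1`. The
topological properties of the group (second countable, locally compact, Hausdorff, Polish) are
inherited from `ℂ × ℂ` through this map. -/
theorem isClosedEmbedding_row : IsClosedEmbedding fun g : SU11 => (g.a, g.b) := by
  let C : Set (ℂ × ℂ) := {p | p.1 * conj p.1 - p.2 * conj p.2 = 1}
  have hC : IsClosed C := isClosed_eq (by fun_prop) (by fun_prop)
  let e : SU11 ≃ₜ C :=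
    { toFun := fun g => ⟨(g.a, g.b), g.det_eq⟩
      invFun := fun p => ofRow p.1.1 p.1.2 p.2
      left_inv := fun g => ext' (by simp) (by simp)
      right_inv := fun p => by simp
      continuous_toFun := by
        exact Continuous.subtype_mk (continuous_a.prodMk continuous_b) _
      continuous_invFun := by
        rw [continuous_iff]
        simp only [ofRow_a, ofRow_b]
        constructor <;> fun_prop }
  exact hC.isClosedEmbedding_subtypeVal.comp e.isClosedEmbedding

instance : SecondCountableTopology SU11 :=
  isClosedEmbedding_row.isEmbedding.secondCountableTopology

instance : LocallyCompactSpace SU11 := isClosedEmbedding_row.locallyCompactSpace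

instance : T2Space SU11 := isClosedEmbedding_row.isEmbedding.t2Space

instance : PolishSpace SU11 := isClosedEmbedding_row.polishSpace

instance : IsTopologicalGroup SU11 := inferInstance

theorem tendsto_nhds_iff {ι : Type*} {l : Filter ι} {f : ι → SU11} {g : SU11} :
    Filter.Tendsto f l (𝓝 g) ↔ Filter.Tendsto (fun i => (f i).a) l (𝓝 g.a) ∧
      Filter.Tendsto (fun i => (f i).b) l (𝓝 g.b) := by
  rw [isClosedEmbedding_row.isEmbedding.tendsto_nhds_iff]
  exact Prod.tendsto_iff _ _

theorem continuous_smul_prod : Continuous fun p : SU11 × 𝔻 => p.1 • p.2 := by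
  rw [Complex.UnitDisc.isEmbedding_coe.continuous_iff]
  have ha := continuous_a
  have hb := continuous_b
  have h : Continuous fun p : SU11 × 𝔻 =>
      (p.1.a * (p.2 : ℂ) + p.1.b) / (conj p.1.b * p.2 + conj p.1.a) :=
    Continuous.div (by fun_prop) (by fun_prop) (fun p => p.1.den_ne_zero p.2)
  exact h

instance : ContinuousSMul SU11 𝔻 := ⟨continuous_smul_prod⟩

end SU11

namespace GTilde

theorem continuous_mat : Continuous mat := continuous_fst.comp continuous_subtype_val

theorem continuous_A : Continuous A := continuous_snd.comp continuous_subtype_val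

theorem continuous_iff {Y : Type*} [TopologicalSpace Y] {f : Y → GTilde} :
    Continuous f ↔ Continuous (fun y => (f y).mat) ∧ Continuous (fun y => (f y).A) :=
  ⟨fun h => ⟨continuous_mat.comp h, continuous_A.comp h⟩,
    fun ⟨h1, h2⟩ => Continuous.subtype_mk (h1.prodMk h2) _⟩

theorem continuous_log_one_add {Y : Type*} [TopologicalSpace Y] {f : Y → ℂ} (hf : Continuous f)
    (h : ∀ y, ‖f y‖ < 1) : Continuous fun y => Complex.log (1 + f y) :=
  (continuous_const.add hf).clog fun y => Or.inl (re_one_add_pos (h y))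

instance : IsTopologicalGroup GTilde where
  continuous_mul := by
    rw [continuous_iff]
    have hm := continuous_mat
    have hA := continuous_A
    have ha := SU11.continuous_a
    have hb := SU11.continuous_b
    refine ⟨(hm.comp continuous_fst).mul (hm.comp continuous_snd), ?_⟩
    refine ((hA.comp continuous_fst).add (hA.comp continuous_snd)).add
      (continuous_log_one_add ?_ fun p => norm_mul_term_lt p.1.mat p.2.mat)
    exact Continuous.div (by fun_prop) (by fun_prop)
      fun p => mul_ne_zero p.1.mat.a_ne_zero p.2.mat.a_ne_zero
  continuous_inv := by
    rw [continuous_iff]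
    exact ⟨continuous_mat.inv, Complex.continuous_conj.comp continuous_A⟩

instance : SecondCountableTopology GTilde :=
  (IsEmbedding.subtypeVal : IsEmbedding fun x : GTilde => x.1).secondCountableTopology

theorem exists_mat_eq (g : SU11) : ∃ x : GTilde, x.mat = g :=
  ⟨⟨(g, Complex.log g.a), Complex.exp_log g.a_ne_zero⟩, rfl⟩

theorem toPSU_surjective : Function.Surjective toPSU := by
  intro x
  obtain ⟨g, rfl⟩ := QuotientGroup.mk_surjective x
  obtain ⟨y, rfl⟩ := exists_mat_eq g
  exact ⟨y, rfl⟩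

theorem continuous_toPSU : Continuous toPSU :=
  QuotientGroup.continuous_mk.comp continuous_mat

theorem continuous_logDen_prod : Continuous fun p : GTilde × 𝔻 => p.1.logDen p.2 := by
  have hm := continuous_mat
  have hA := continuous_A
  have ha := SU11.continuous_a
  have hb := SU11.continuous_b
  unfold logDen
  refine (hA.comp continuous_fst).add ?_
  simp only [sub_eq_add_neg]
  refine continuous_log_one_add ?_ fun p => norm_log_term_lt p.1 p.2
  refine (Continuous.mul (Continuous.div (by fun_prop) (by fun_prop) ?_) (by fun_prop)).neg
  exact fun p => p.1.mat.a_ne_zero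

theorem mat_center_zpow (k : ℤ) : (center ^ k).mat = SU11.negOne ^ k := map_zpow toSU center k

theorem A_center_zpow (k : ℤ) : (center ^ k).A = k * (Complex.I * Real.pi) := by
  have hmul : ∀ g : GTilde, (g * center).A = g.A + Complex.I * Real.pi := by
    intro g; rw [A_mul]; simp
  induction k with
  | zero => simp
  | succ n ih => rw [zpow_add_one, hmul, ih]; push_cast; ring
  | pred n ih =>
    have h := hmul (center ^ (-(n : ℤ) - 1))
    rw [← zpow_add_one, sub_add_cancel, ih] at h
    push_cast at h ⊢
    linear_combination -h

theorem negOne_sq : SU11.negOne * SU11.negOne = 1 := by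
  apply SU11.ext' <;> simp [SU11.mul_a, SU11.mul_b]

theorem mem_zpowers_negOne {g : SU11} (h : g ∈ Subgroup.zpowers SU11.negOne) :
    g = 1 ∨ g = SU11.negOne := by
  obtain ⟨k, rfl⟩ := Subgroup.mem_zpowers_iff.1 h
  have h2 : SU11.negOne ^ (2 : ℤ) = 1 := by rw [zpow_two, negOne_sq]
  rcases Int.even_or_odd' k with ⟨l, rfl | rfl⟩
  · left; rw [zpow_mul, h2, one_zpow]
  · right; rw [zpow_add_one, zpow_mul, h2, one_zpow, one_mul]

theorem toPSU_eq_one {g : GTilde} (h : g.toPSU = 1) : ∃ k : ℤ, g = center ^ k := by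
  have h1 : g.mat ∈ Subgroup.zpowers SU11.negOne := (QuotientGroup.eq_one_iff g.mat).1 h
  obtain ⟨k, hk⟩ := Subgroup.mem_zpowers_iff.1 h1
  have h2 : Complex.exp g.A = Complex.exp (center ^ k).A := by
    rw [exp_A, exp_A, mat_center_zpow, hk]
  obtain ⟨n, hn⟩ := Complex.exp_eq_exp_iff_exists_int.1 h2
  -- The matrix fixes the power of `center` only modulo 2; the remaining difference `2πi n` of the
  -- logarithms is the logarithm carried by `center ^ (2 * n)`.
  refine ⟨k + 2 * n, ext' ?_ ?_⟩
  · rw [mat_center_zpow, zpow_add, hk, zpow_mul, zpow_two, negOne_sq, one_zpow, mul_one]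
  · rw [hn, A_center_zpow, A_center_zpow]; push_cast; ring

end GTilde

/-! ### Continuity of the action on differentials. -/

theorem continuous_actFun_prod (m : ℝ) {f : 𝔻 → ℂ} (hf : Continuous f) :
    Continuous fun p : GTilde × 𝔻 => actFun m p.1 f p.2 := by
  have h1 : Continuous fun p : GTilde × 𝔻 => (p.1.mat⁻¹, p.2) :=
    (GTilde.continuous_mat.comp continuous_fst).inv.prodMk continuous_snd
  have h2 : Continuous fun p : GTilde × 𝔻 => p.1.mat⁻¹ • p.2 :=
    h1.fst.smul h1.snd
  have h3 : Continuous fun p : GTilde × 𝔻 => f (p.1.mat⁻¹ • p.2) := hf.comp h2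
  have h4 := GTilde.continuous_logDen_prod
  have h5 : Continuous fun p : GTilde × 𝔻 => Complex.exp (-2 * m * p.1.logDen p.2) := by
    fun_prop
  exact h3.mul h5

/-- Joint continuity in the group element and the point becomes, after currying, continuity into the
compact-open topology. -/
theorem continuous_rho_apply (m : ℝ) (θ : Hol) : Continuous fun g : GTilde => rho m g θ := by
  have h := (ContinuousMap.curry ⟨_, continuous_actFun_prod m θ.1.continuous⟩).continuous
  rw [continuous_induced_rng]
  exact h


/-! ### Recurrence and push-forward of invariant measures -/

section General

open scoped Pointwise

variable {Γ Γ' : Type*} [Group Γ] [TopologicalSpace Γ]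
  [Group Γ'] [TopologicalSpace Γ']

/-- The translates of the image of `U` are open, cover the quotient and have equal measure. If they
were null, the whole measure would be locally null, hence zero. -/
theorem measure_open_ne_zero [IsTopologicalGroup Γ] [SecondCountableTopology Γ]
    {S : Subgroup Γ}
    {μ : @Measure (Γ ⧸ S) (borel (Γ ⧸ S))} (hinv : IsInvariantOn S μ) (h0 : μ Set.univ ≠ 0)
    {U : Set Γ} (hU : IsOpen U) (h1 : (1 : Γ) ∈ U) :
    μ ((QuotientGroup.mk : Γ → Γ ⧸ S) '' U) ≠ 0 := by
  let _ : MeasurableSpace (Γ ⧸ S) := borel (Γ ⧸ S)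
  have : BorelSpace (Γ ⧸ S) := ⟨rfl⟩
  have : SMulInvariantMeasure Γ (Γ ⧸ S) μ := hinv
  intro hz
  refine h0 (measure_null_of_locally_null _ fun x _ => ?_)
  obtain ⟨g, rfl⟩ := QuotientGroup.mk_surjective x
  refine ⟨g • ((QuotientGroup.mk : Γ → Γ ⧸ S) '' U), ?_, ?_⟩
  · refine mem_nhdsWithin_of_mem_nhds (IsOpen.mem_nhds ?_ ?_)
    · exact (QuotientGroup.isOpenMap_coe U hU).smul g
    · exact ⟨_, ⟨1, h1, rfl⟩, by
        change ((g * 1 : Γ) : Γ ⧸ S) = g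
        rw [mul_one]⟩
  · rw [measure_smul, hz]

/-- Poincaré recurrence: among infinitely many translates of a neighbourhood of the base point of
a homogeneous space of finite invariant volume, two meet. -/
theorem exists_translates_meet [IsTopologicalGroup Γ] [SecondCountableTopology Γ]
    {S : Subgroup Γ}
    {μ : @Measure (Γ ⧸ S) (borel (Γ ⧸ S))} (hinv : IsInvariantOn S μ) (h0 : μ Set.univ ≠ 0)
    (htop : μ Set.univ ≠ ⊤) {V : Set Γ} (hV : V ∈ 𝓝 (1 : Γ)) (b : ℕ → Γ) :
    ∃ i j, i < j ∧ ∃ v ∈ V, ∃ w ∈ V, v⁻¹ * ((b i)⁻¹ * b j) * w ∈ S := by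
  let _ : MeasurableSpace (Γ ⧸ S) := borel (Γ ⧸ S)
  have : BorelSpace (Γ ⧸ S) := ⟨rfl⟩
  have : SMulInvariantMeasure Γ (Γ ⧸ S) μ := hinv
  have hpos := measure_open_ne_zero hinv h0 isOpen_interior (mem_interior_iff_mem_nhds.2 hV)
  have hopen := QuotientGroup.isOpenMap_coe (N := S) (interior V) isOpen_interior
  obtain ⟨i, j, hij, x, hxi, hxj⟩ := exists_nonempty_inter_of_measure_univ_lt_tsum_measure μ
    (s := fun i => b i • ((QuotientGroup.mk : Γ → Γ ⧸ S) '' interior V))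
    (fun i => (hopen.smul (b i)).measurableSet.nullMeasurableSet) (by
      simp only [measure_smul]
      rw [ENNReal.tsum_const_eq_top_of_ne_zero hpos]
      exact htop.lt_top)
  obtain ⟨_, ⟨v, hv, rfl⟩, hv'⟩ := hxi
  obtain ⟨_, ⟨w, hw, rfl⟩, hw'⟩ := hxj
  have h1 : ((b i * v : Γ) : Γ ⧸ S) = (b j * w : Γ) := hv'.trans hw'.symm
  have h2 := QuotientGroup.eq.1 h1
  rcases lt_or_gt_of_ne hij with h | h
  · refine ⟨i, j, h, v, interior_subset hv, w, interior_subset hw, ?_⟩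
    convert h2 using 1; group
  · refine ⟨j, i, h, w, interior_subset hw, v, interior_subset hv, ?_⟩
    convert S.inv_mem h2 using 1; group

/-- The map of homogeneous spaces induced by a homomorphism. -/
def cosetMap (φ : Γ →* Γ') {H : Subgroup Γ} {H' : Subgroup Γ'} (h : H ≤ H'.comap φ) :
    Γ ⧸ H → Γ' ⧸ H' :=
  Quotient.map' φ fun x y hxy => by
    rw [QuotientGroup.leftRel_apply] at hxy ⊢
    rw [← map_inv, ← map_mul]
    exact h hxy

theorem continuous_cosetMap {φ : Γ →* Γ'} (hφ : Continuous φ) {H : Subgroup Γ} {H' : Subgroup Γ'}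
    (h : H ≤ H'.comap φ) : Continuous (cosetMap φ h) :=
  hφ.quotient_map' _

/-- The push-forward of a measure under `cosetMap`. -/
def pushCoset (φ : Γ →* Γ') {H : Subgroup Γ} {H' : Subgroup Γ'} (h : H ≤ H'.comap φ)
    (μ : @Measure (Γ ⧸ H) (borel (Γ ⧸ H))) : @Measure (Γ' ⧸ H') (borel (Γ' ⧸ H')) :=
  letI : MeasurableSpace (Γ ⧸ H) := borel (Γ ⧸ H)
  letI : MeasurableSpace (Γ' ⧸ H') := borel (Γ' ⧸ H')
  μ.map (cosetMap φ h)

/-- Surjectivity lifts every translation of the target to a translation of the source, and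
`cosetMap` intertwines the two. -/
theorem isInvariantOn_pushCoset [IsTopologicalGroup Γ'] {φ : Γ →* Γ'} (hφ : Continuous φ) (hs : Function.Surjective φ)
    {H : Subgroup Γ} {H' : Subgroup Γ'} (h : H ≤ H'.comap φ)
    {μ : @Measure (Γ ⧸ H) (borel (Γ ⧸ H))} (hμ : IsInvariantOn H μ) :
    IsInvariantOn H' (pushCoset φ h μ) := by
  let _ : MeasurableSpace (Γ ⧸ H) := borel (Γ ⧸ H)
  have : BorelSpace (Γ ⧸ H) := ⟨rfl⟩
  let _ : MeasurableSpace (Γ' ⧸ H') := borel (Γ' ⧸ H')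
  have : BorelSpace (Γ' ⧸ H') := ⟨rfl⟩
  have : SMulInvariantMeasure Γ (Γ ⧸ H) μ := hμ
  have hm : Measurable (cosetMap φ h) := (continuous_cosetMap hφ h).measurable
  refine ⟨fun c s hs' => ?_⟩
  obtain ⟨g, rfl⟩ := hs c
  change (μ.map (cosetMap φ h)) _ = (μ.map (cosetMap φ h)) s
  rw [Measure.map_apply hm hs', Measure.map_apply hm (measurable_const_smul (φ g) hs'),
    ← measure_preimage_smul μ g (cosetMap φ h ⁻¹' s)]
  congr 1
  ext x
  obtain ⟨y, rfl⟩ := QuotientGroup.mk_surjective x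
  change (φ g • ((φ y : Γ') : Γ' ⧸ H')) ∈ s ↔ ((φ (g * y) : Γ') : Γ' ⧸ H') ∈ s
  rw [map_mul]; rfl

theorem pushCoset_univ {φ : Γ →* Γ'} (hφ : Continuous φ)
    {H : Subgroup Γ} {H' : Subgroup Γ'} (h : H ≤ H'.comap φ)
    (μ : @Measure (Γ ⧸ H) (borel (Γ ⧸ H))) : pushCoset φ h μ Set.univ = μ Set.univ := by
  let _ : MeasurableSpace (Γ ⧸ H) := borel (Γ ⧸ H)
  have : BorelSpace (Γ ⧸ H) := ⟨rfl⟩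
  let _ : MeasurableSpace (Γ' ⧸ H') := borel (Γ' ⧸ H')
  have : BorelSpace (Γ' ⧸ H') := ⟨rfl⟩
  have hm : Measurable (cosetMap φ h) := (continuous_cosetMap hφ h).measurable
  exact Measure.map_apply hm MeasurableSet.univ

/-- Finite covolume is inherited along a surjection as soon as the image of `H` lies in `H'`; only
discreteness has to be supplied separately. -/
theorem isLattice_of_hom [IsTopologicalGroup Γ'] {φ : Γ →* Γ'} (hφ : Continuous φ) (hs : Function.Surjective φ)
    {H : Subgroup Γ} {H' : Subgroup Γ'} (h : H ≤ H'.comap φ)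
    {μ : @Measure (Γ ⧸ H) (borel (Γ ⧸ H))} (hμ : IsInvariantOn H μ) (h0 : μ Set.univ ≠ 0)
    (htop : μ Set.univ ≠ ⊤) (hd : DiscreteTopology H') : IsLattice H' :=
  ⟨hd, pushCoset φ h μ, isInvariantOn_pushCoset hφ hs h hμ,
    by rwa [pushCoset_univ hφ], by rwa [pushCoset_univ hφ]⟩

theorem discreteTopology_of_nhds [IsTopologicalGroup Γ] {H : Subgroup Γ} {W : Set Γ} (hW : W ∈ 𝓝 (1 : Γ))
    (h : ∀ g ∈ W, g ∈ H → g = 1) : DiscreteTopology H := by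
  refine discreteTopology_of_isOpen_singleton_one ?_
  refine isOpen_singleton_iff_nhds_eq_pure _ |>.2 ?_
  refine le_antisymm ?_ (pure_le_nhds _)
  rw [Filter.le_pure_iff]
  refine Filter.mem_of_superset (continuous_subtype_val.continuousAt.preimage_mem_nhds hW) ?_
  intro x hx
  exact Subtype.ext (h x hx x.2)

end General


/-! ### Functions on the disc with many symmetries -/

/-- The holomorphic vector field on the disc generated by the element
`(i α / 2, β; conj β, -i α / 2)` of the Lie algebra of `SU(1,1)`. -/
def killingField (β : ℂ) (α : ℝ) (z : ℂ) : ℂ := β + Complex.I * α * z - conj β * z ^ 2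

/-- The elements of `SU(1,1)` which leave a function on the disc invariant. -/
def symmetryGroup (h : ℂ → ℝ) : Subgroup SU11 where
  carrier := {g | ∀ z : 𝔻, h (g • z : 𝔻) = h z}
  one_mem' z := by rw [one_smul]
  mul_mem' {g k} hg hk z := by rw [mul_smul, hg, hk]
  inv_mem' {g} hg z := by rw [← hg (g⁻¹ • z), smul_inv_smul]

/-- The derivative of `h` along the vector field `killingField β α` vanishes. -/
def IsAnnihilated (h : ℂ → ℝ) (β : ℂ) (α : ℝ) : Prop :=
  ∀ z : 𝔻, fderiv ℝ h z (killingField β α z) = 0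

theorem UnitDisc.exists_coe_eq {z : ℂ} (hz : z ∈ Metric.ball (0 : ℂ) 1) : ∃ w : 𝔻, (w : ℂ) = z :=
  ⟨Complex.UnitDisc.mk z (mem_ball_zero_iff.1 hz), rfl⟩

theorem UnitDisc.coe_mem_ball (z : 𝔻) : (z : ℂ) ∈ Metric.ball (0 : ℂ) 1 :=
  mem_ball_zero_iff.2 z.norm_lt_one

section Symmetry

variable {h : ℂ → ℝ}

open Filter

/-- The coordinates of `g n` near the identity are normalized to the unit sphere, and a convergent
subsequence is taken. Its limit is the required Lie algebra direction: the difference quotients of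
`h` along `g n • z - z` all vanish, and they converge to the derivative along the limiting field. -/
theorem exists_isAnnihilated_of_tendsto_one (hd : ∀ z : 𝔻, DifferentiableAt ℝ h z)
    {g : ℕ → SU11} (hg : ∀ n, g n ∈ symmetryGroup h) (hlim : Tendsto g atTop (𝓝 1))
    (hne : ∀ n, g n ≠ 1) (hre : ∀ n, 0 < (g n).a.re) :
    ∃ (β : ℂ) (α : ℝ), (β ≠ 0 ∨ α ≠ 0) ∧ IsAnnihilated h β α := by
  -- To first order `a = 1 + iα/2`, so `α` corresponds to `2 Im a`. The real part of `a` is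
  -- recovered from the determinant and its positivity.
  let x : ℕ → ℂ × ℝ := fun n => ((g n).b, 2 * (g n).a.im)
  have hx : ∀ n, x n ≠ 0 := by
    intro n h0
    have hb : (g n).b = 0 := congrArg Prod.fst h0
    have hi : (g n).a.im = 0 := by
      have : 2 * (g n).a.im = 0 := congrArg Prod.snd h0
      linarith
    have hn := (g n).norm_sq_eq
    rw [hb, norm_zero, ← Complex.normSq_eq_norm_sq, Complex.normSq_apply, hi] at hn
    have hr : (g n).a.re = 1 := by nlinarith [hre n]
    exact hne n (SU11.ext' (Complex.ext (by simpa using hr) (by simpa using hi)) (by simpa using hb))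
  let y : ℕ → ℂ × ℝ := fun n => ‖x n‖⁻¹ • x n
  have hy : ∀ n, y n ∈ Metric.sphere (0 : ℂ × ℝ) 1 := fun n => by
    rw [mem_sphere_zero_iff_norm]
    exact norm_smul_inv_norm (𝕜 := ℝ) (hx n)
  obtain ⟨p, hp, φ, hφ, hyp⟩ := (isCompact_sphere (0 : ℂ × ℝ) 1).tendsto_subseq hy
  refine ⟨p.1, p.2, ?_, fun z => ?_⟩
  · by_contra! h0
    have : p = 0 := Prod.ext h0.1 h0.2
    simp [this] at hp
  have hlim' : Tendsto (fun n => g (φ n)) atTop (𝓝 1) := hlim.comp hφ.tendsto_atTop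
  have hab := SU11.tendsto_nhds_iff.1 hlim'
  rw [SU11.one_a, SU11.one_b] at hab
  have hden : Tendsto (fun n => conj (g (φ n)).b * (z : ℂ) + conj (g (φ n)).a) atTop (𝓝 1) := by
    have h1 := ((Complex.continuous_conj.tendsto 0).comp hab.2).mul_const (z : ℂ)
    have h2 := (Complex.continuous_conj.tendsto 1).comp hab.1
    simpa using h1.add h2
  have hfield : Tendsto (fun n => killingField (y (φ n)).1 (y (φ n)).2 z) atTop
      (𝓝 (killingField p.1 p.2 z)) := by
    have hc : Continuous fun q : ℂ × ℝ => killingField q.1 q.2 z := by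
      unfold killingField; fun_prop
    exact (hc.tendsto p).comp hyp
  -- The displacement is exact, not only asymptotic: `g z - z` is the Killing field with parameters
  -- `b`, `2 Im a`, divided by `conj b z + conj a`.
  have hquot : ∀ n, ‖x (φ n)‖⁻¹ • (((g (φ n) • z : 𝔻) : ℂ) - z)
      = killingField (y (φ n)).1 (y (φ n)).2 z
        / (conj (g (φ n)).b * (z : ℂ) + conj (g (φ n)).a) := by
    intro n
    have h0 := (g (φ n)).den_ne_zero z
    have him : (g (φ n)).a - conj (g (φ n)).a = Complex.I * ((2 * (g (φ n)).a.im : ℝ) : ℂ) := by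
      rw [Complex.sub_conj]; ring
    rw [SU11.coe_smul, eq_div_iff h0, Complex.real_smul, mul_assoc, sub_mul, div_mul_cancel₀ _ h0]
    simp only [y, x, killingField, Prod.smul_fst, Prod.smul_snd, Complex.real_smul, map_mul,
      Complex.conj_ofReal, smul_eq_mul, Complex.ofReal_mul] at him ⊢
    linear_combination (↑(‖((g (φ n)).b, 2 * (g (φ n)).a.im)‖⁻¹) : ℂ) * z * him
  have hd0 : Tendsto (fun n => ((g (φ n) • z : 𝔻) : ℂ) - z) atTop (𝓝 0) := by
    have h1 : Tendsto (fun n => g (φ n) • z) atTop (𝓝 ((1 : SU11) • z)) :=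
      hlim'.smul tendsto_const_nhds
    rw [one_smul] at h1
    have h2 := (Complex.UnitDisc.continuous_coe.tendsto z).comp h1
    simpa using h2.sub_const (z : ℂ)
  have hq : Tendsto (fun n => ‖x (φ n)‖⁻¹ • (((g (φ n) • z : 𝔻) : ℂ) - z)) atTop
      (𝓝 (killingField p.1 p.2 z)) := by
    simp only [hquot]
    rw [← div_one (killingField p.1 p.2 z)]
    exact hfield.div hden one_ne_zero
  have hl := (hasFDerivWithinAt_univ.2 (hd z).hasFDerivAt).lim hd0
    (Eventually.of_forall fun _ => Set.mem_univ _) hq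
  refine tendsto_nhds_unique hl ?_
  have hz : ∀ n, ‖x (φ n)‖⁻¹ • (h ((z : ℂ) + (((g (φ n) • z : 𝔻) : ℂ) - z)) - h z) = 0 := by
    intro n
    rw [add_sub_cancel, hg (φ n) z, sub_self, smul_zero]
  simp only [hz]
  exact tendsto_const_nhds

theorem SU11.hasDerivAt_smul (g : SU11) (z : 𝔻) :
    HasDerivAt (fun w : ℂ => (g.a * w + g.b) / (conj g.b * w + conj g.a))
      (1 / (conj g.b * z + conj g.a) ^ 2) z := by
  have h0 := g.den_ne_zero z
  have h1 : HasDerivAt (fun w : ℂ => g.a * w + g.b) g.a z := by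
    simpa using ((hasDerivAt_id (z : ℂ)).const_mul g.a).add_const g.b
  have h2 : HasDerivAt (fun w : ℂ => conj g.b * w + conj g.a) (conj g.b) z := by
    simpa using ((hasDerivAt_id (z : ℂ)).const_mul (conj g.b)).add_const (conj g.a)
  have h3 : g.a * (conj g.b * z + conj g.a) - (g.a * z + g.b) * conj g.b = 1 := by
    linear_combination g.det_eq
  have h4 := h1.div h2 h0
  rwa [h3] at h4

theorem fderiv_smul_of_mem_symmetryGroup (hd : ∀ z : 𝔻, DifferentiableAt ℝ h z) {k : SU11}
    (hk : k ∈ symmetryGroup h) (z : 𝔻) (v : ℂ) :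
    fderiv ℝ h (k • z : 𝔻) (v / (conj k.b * z + conj k.a) ^ 2) = fderiv ℝ h z v := by
  let φ : ℂ → ℂ := fun w => (k.a * w + k.b) / (conj k.b * w + conj k.a)
  have h1 : HasFDerivAt φ _ (z : ℂ) := (k.hasDerivAt_smul z).hasFDerivAt.restrictScalars ℝ
  have h2 : HasFDerivAt h (fderiv ℝ h (k • z : 𝔻)) (φ z) := (hd (k • z)).hasFDerivAt
  have h3 := h2.comp (z : ℂ) h1
  have h4 : h ∘ φ =ᶠ[𝓝 (z : ℂ)] h := by
    filter_upwards [Metric.isOpen_ball.mem_nhds (UnitDisc.coe_mem_ball z)] with w hw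
    obtain ⟨w, rfl⟩ := UnitDisc.exists_coe_eq hw
    exact hk w
  have h5 := (h3.congr_of_eventuallyEq h4.symm).fderiv
  rw [h5]
  simp [div_eq_mul_inv]

/-- The direct image of `killingField β α` under the element of `SU(1,1)` with first row
`(a, b)`. -/
def movedField (β : ℂ) (α : ℝ) (a b w : ℂ) : ℂ :=
  β * (a - conj b * w) ^ 2 + Complex.I * α * (conj a * w - b) * (a - conj b * w)
    - conj β * (conj a * w - b) ^ 2

theorem continuous_movedField (β : ℂ) (α : ℝ) (w : ℂ) :
    Continuous fun q : ℂ × ℂ => movedField β α q.1 q.2 w := by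
  unfold movedField
  fun_prop

theorem movedField_div (β : ℂ) (α : ℝ) (a b w : ℂ) (r : ℝ) :
    movedField β α (a / r) (b / r) w = ((r⁻¹) ^ 2 : ℝ) • movedField β α a b w := by
  simp only [movedField, map_div₀, Complex.conj_ofReal, Complex.real_smul]
  push_cast
  ring

/-- The row `(1, u)` belongs to a matrix of rank one: both `w - u` and `1 - conj u w` are multiples
of `w - u`. So every field degenerates to a multiple of the parabolic field `i conj u (w - u)²`,
which has a double zero at the boundary point `u`. -/
theorem movedField_one (β : ℂ) (α : ℝ) {u : ℂ} (hu : ‖u‖ = 1) (w : ℂ) :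
    movedField β α 1 u w
      = (-α + 2 * (β * conj u).im) • killingField (Complex.I * u) (-2) w := by
  have huu : u * conj u = 1 := by rw [Complex.mul_conj', hu]; simp
  have him : Complex.I * (2 * (β * conj u).im : ℝ) = β * conj u - conj β * u := by
    have := Complex.sub_conj (β * conj u)
    rw [map_mul, Complex.conj_conj] at this
    rw [this]; ring
  rw [Complex.real_smul, killingField, movedField]
  simp only [map_one, map_mul, Complex.conj_I] at him ⊢
  push_cast at him ⊢
  linear_combination (-(u - 2 * w + conj u * w ^ 2)) * him
    + (Complex.I * α * w - β + conj β * w ^ 2) * huu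

/-- Chain rule for the symmetry `k`. The derivative of `k` cancels the denominators of the field at
`k⁻¹ • w`, and the result is a quadratic polynomial in the row of `k` and its conjugate. This form
can be rescaled and passed to the limit at the boundary. -/
theorem isAnnihilated_smul (hd : ∀ z : 𝔻, DifferentiableAt ℝ h z) {β : ℂ} {α : ℝ}
    (hβ : IsAnnihilated h β α) {k : SU11} (hk : k ∈ symmetryGroup h) (w : 𝔻) :
    fderiv ℝ h w (movedField β α k.a k.b w) = 0 := by
  have h1 := fderiv_smul_of_mem_symmetryGroup hd hk (k⁻¹ • w)
    (killingField β α (k⁻¹ • w : 𝔻))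
  rw [hβ, smul_inv_smul] at h1
  rw [← h1]
  congr 1
  have hd0 := (k⁻¹).den_ne_zero w
  have hd1 := k.den_ne_zero (k⁻¹ • w)
  rw [eq_div_iff (pow_ne_zero 2 hd1)]
  rw [SU11.coe_smul] at hd1 ⊢
  simp only [SU11.inv_a, SU11.inv_b, map_neg, Complex.conj_conj, killingField, movedField]
    at hd0 hd1 ⊢
  have hD : k.a - conj k.b * (w : ℂ) = -conj k.b * w + k.a := by ring
  rw [hD]
  have hdet : conj k.b * (conj k.a * (w : ℂ) + -k.b) + conj k.a * (-conj k.b * (w : ℂ) + k.a) = 1 := by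
    linear_combination k.det_eq
  generalize -conj k.b * (w : ℂ) + k.a = D at *
  have hden : conj k.b * ((conj k.a * (w : ℂ) + -k.b) / D) + conj k.a = 1 / D := by
    rw [eq_div_iff hd0, ← hdet]
    field_simp
  rw [hden]
  field_simp
  ring

/-- Rescaling a field by a real number keeps it annihilating, so the rescaled moved fields may go to
the limit. The limit is the parabolic field at `u` times the coefficient in `hc`, whence the
nonvanishing assumption. -/
theorem isAnnihilated_of_tendsto (hd : ∀ z : 𝔻, DifferentiableAt ℝ h z) {β : ℂ} {α : ℝ}
    (hβ : IsAnnihilated h β α) {u : ℂ} (hu : ‖u‖ = 1) {k : ℕ → SU11} {r : ℕ → ℝ}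
    (hk : ∀ n, k n ∈ symmetryGroup h)
    (ha : Tendsto (fun n => (k n).a / r n) atTop (𝓝 1))
    (hb : Tendsto (fun n => (k n).b / r n) atTop (𝓝 u))
    (hc : -α + 2 * (β * conj u).im ≠ 0) : IsAnnihilated h (Complex.I * u) (-2) := by
  intro w
  have key : ∀ n, fderiv ℝ h w (movedField β α ((k n).a / r n) ((k n).b / r n) w) = 0 := fun n => by
    rw [movedField_div, map_smul, isAnnihilated_smul hd hβ (hk n) w, smul_zero]
  have hlim := ((fderiv ℝ h w).continuous.comp (continuous_movedField β α w)).tendsto (1, u)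
  have h0 := tendsto_nhds_unique (hlim.comp (ha.prodMk_nhds hb))
    (tendsto_const_nhds.congr fun n => (key n).symm)
  simp only [Function.comp_apply] at h0
  rw [movedField_one β α hu, map_smul, smul_eq_mul] at h0
  exact (mul_eq_zero.1 h0).resolve_left hc

/-- The first rows of the elements of a set accumulate projectively at all points `(1, u)`,
`‖u‖ = 1`. -/
def AccumulatesAtBoundary (K : Set SU11) : Prop :=
  ∀ u : ℂ, ‖u‖ = 1 → ∃ (k : ℕ → SU11) (r : ℕ → ℝ), (∀ n, k n ∈ K) ∧
    Tendsto (fun n => (k n).a / r n) atTop (𝓝 1) ∧ Tendsto (fun n => (k n).b / r n) atTop (𝓝 u)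

/-- One annihilating field produces a parabolic one at some `u`, and this one produces those at `iu`
and `-iu`. At every point of the disc these three vectors span the tangent plane over the reals. -/
theorem fderiv_eq_zero_of_isAnnihilated (hd : ∀ z : 𝔻, DifferentiableAt ℝ h z)
    (hK : AccumulatesAtBoundary (symmetryGroup h)) {β : ℂ} {α : ℝ} (h0 : β ≠ 0 ∨ α ≠ 0)
    (hβ : IsAnnihilated h β α) (w : 𝔻) : fderiv ℝ h w = 0 := by
  have step : ∀ {β : ℂ} {α : ℝ}, IsAnnihilated h β α → ∀ u : ℂ, ‖u‖ = 1 →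
      -α + 2 * (β * conj u).im ≠ 0 → IsAnnihilated h (Complex.I * u) (-2) := by
    intro β α hβ u hu hc
    obtain ⟨k, r, hk, ha, hb⟩ := hK u hu
    exact isAnnihilated_of_tendsto hd hβ hu hk ha hb hc
  obtain ⟨u, hu, hu'⟩ : ∃ u : ℂ, ‖u‖ = 1 ∧ IsAnnihilated h (Complex.I * u) (-2) := by
    by_contra! hne
    have h1 : ∀ u : ℂ, ‖u‖ = 1 → -α + 2 * (β * conj u).im = 0 := fun u hu => by
      by_contra hc
      exact hne u hu (step hβ u hu hc)
    -- The coefficient is affine in `u`; its vanishing at `1`, `-1` and `i` already forces both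
    -- parameters of the field to be zero.
    have e1 := h1 1 (by simp)
    have e2 := h1 (-1) (by simp)
    have e3 := h1 Complex.I (by simp)
    simp at e1 e2 e3
    have ha : α = 0 := by linarith
    have hb : β = 0 := Complex.ext (by simp; linarith) (by simp; linarith)
    exact h0.elim (· hb) (· ha)
  have huu : u * conj u = 1 := by rw [Complex.mul_conj', hu]; simp
  -- Starting from the parabolic field at `u`, the coefficient at another boundary point vanishes
  -- only at `-u`; at `iu` and `-iu` it equals 2.
  have h2 := step hu' (Complex.I * u) (by simp [hu]) (by
    have : Complex.I * u * conj (Complex.I * u) = 1 := by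
      rw [map_mul, Complex.conj_I]; linear_combination huu - u * conj u * Complex.I_sq
    rw [this]; simp) w
  have h3 := step hu' (-(Complex.I * u)) (by simp [hu]) (by
    have : Complex.I * u * conj (-(Complex.I * u)) = -1 := by
      rw [map_neg, map_mul, Complex.conj_I]
      linear_combination -huu + u * conj u * Complex.I_sq
    rw [this]; simp) w
  have h1 := hu' w
  set T := fderiv ℝ h w with hT
  simp only [killingField, map_mul, map_neg, Complex.conj_I] at h1 h2 h3
  have e1 : T (u - conj u * w ^ 2) = 0 := by
    have : (u - conj u * (w : ℂ) ^ 2) = (-(1 / 2) : ℝ) • (((Complex.I * (Complex.I * u)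
        + Complex.I * ((-2 : ℝ) : ℂ) * w - -Complex.I * (-Complex.I * conj u) * (w : ℂ) ^ 2))
        - (Complex.I * -(Complex.I * u) + Complex.I * ((-2 : ℝ) : ℂ) * w
          - -Complex.I * -(-Complex.I * conj u) * (w : ℂ) ^ 2)) := by
      rw [Complex.real_smul]; push_cast
      linear_combination (u - conj u * (w : ℂ) ^ 2) * Complex.I_sq
    rw [this, map_smul, map_sub, h2, h3]; simp
  have e2 : T (Complex.I * (u + conj u * w ^ 2)) = 0 := by
    have : Complex.I * (u + conj u * (w : ℂ) ^ 2) = (Complex.I * u + Complex.I * ((-2 : ℝ) : ℂ) * w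
        - -Complex.I * conj u * (w : ℂ) ^ 2)
        - (1 / 2 : ℝ) • (((Complex.I * (Complex.I * u)
        + Complex.I * ((-2 : ℝ) : ℂ) * w - -Complex.I * (-Complex.I * conj u) * (w : ℂ) ^ 2))
        + (Complex.I * -(Complex.I * u) + Complex.I * ((-2 : ℝ) : ℂ) * w
          - -Complex.I * -(-Complex.I * conj u) * (w : ℂ) ^ 2)) := by
      rw [Complex.real_smul]; push_cast
      ring
    rw [this, map_sub, map_smul, map_add, h1, h2, h3]; simp
  ext v
  -- `x • (u - conj u w²) + y • I (u + conj u w²) = p - conj p w²` for `p = (x + y I) u`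
  have hw : 1 - ‖(w : ℂ)‖ ^ 4 ≠ 0 := by
    have h4 := w.sq_norm_lt_one
    have h5 : ‖(w : ℂ)‖ ^ 4 = (‖(w : ℂ)‖ ^ 2) ^ 2 := by ring
    rw [h5]
    nlinarith [sq_nonneg ‖(w : ℂ)‖]
  -- The real linear equation `v = q - conj q w²` has determinant `1 - |w|⁴`; its solution `q` is
  -- written as `p u`.
  set p : ℂ := (v + conj v * (w : ℂ) ^ 2) / ((1 - ‖(w : ℂ)‖ ^ 4 : ℝ) : ℂ) * conj u with hp
  have hv : v = p.re • (u - conj u * (w : ℂ) ^ 2) + p.im • (Complex.I * (u + conj u * w ^ 2)) := by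
    have hn : (w : ℂ) * conj (w : ℂ) = (‖(w : ℂ)‖ : ℂ) ^ 2 := Complex.mul_conj' _
    have hw' : ((1 - ‖(w : ℂ)‖ ^ 4 : ℝ) : ℂ) ≠ 0 := by exact_mod_cast hw
    have h6 : p.re • (u - conj u * (w : ℂ) ^ 2) + p.im • (Complex.I * (u + conj u * (w : ℂ) ^ 2))
        = p * u - conj p * conj u * (w : ℂ) ^ 2 := by
      have hp1 : (p.re : ℂ) + p.im * Complex.I = p := Complex.re_add_im p
      have hp2 : (p.re : ℂ) - p.im * Complex.I = conj p := by
        apply Complex.ext <;> simp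
      rw [Complex.real_smul, Complex.real_smul, ← hp2]
      linear_combination u * hp1
    rw [h6, hp]
    simp only [map_mul, map_div₀, map_add, map_pow, Complex.conj_conj, Complex.conj_ofReal]
    have h7 : ((1 - ‖(w : ℂ)‖ ^ 4 : ℝ) : ℂ) = 1 - ((w : ℂ) * conj (w : ℂ)) ^ 2 := by
      rw [hn]; push_cast; ring
    have h8 : v * ((1 - ‖(w : ℂ)‖ ^ 4 : ℝ) : ℂ) = (v + conj v * (w : ℂ) ^ 2) * (u * conj u)
        - (conj v + v * conj (w : ℂ) ^ 2) * (u * conj u) * (w : ℂ) ^ 2 := by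
      rw [h7, huu]; ring
    refine mul_right_cancel₀ hw' ?_
    rw [h8]
    field_simp
  rw [hv, map_add, map_smul, map_smul, e1, e2]
  simp

end Symmetry


/-! ### Boosts and accumulation at the boundary -/

namespace SU11

/-- The hyperbolic element `(cosh t, u sinh t; conj u sinh t, cosh t)`. -/
def boost (u : ℂ) (hu : ‖u‖ = 1) (t : ℝ) : SU11 :=
  ofRow (Real.cosh t) (Real.sinh t * u) (by
    have huu : u * conj u = 1 := by rw [Complex.mul_conj', hu]; simp
    have h : ((Real.cosh t : ℂ)) ^ 2 - (Real.sinh t : ℂ) ^ 2 = 1 := by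
      exact_mod_cast Real.cosh_sq_sub_sinh_sq t
    rw [map_mul, Complex.conj_ofReal, Complex.conj_ofReal]
    linear_combination h - (Real.sinh t : ℂ) ^ 2 * huu)

theorem boost_add (u : ℂ) (hu : ‖u‖ = 1) (s t : ℝ) :
    boost u hu (s + t) = boost u hu s * boost u hu t := by
  have huu : u * conj u = 1 := by rw [Complex.mul_conj', hu]; simp
  apply ext'
  · simp only [boost, ofRow_a, mul_a, ofRow_b, Real.cosh_add, map_mul, Complex.conj_ofReal]
    push_cast
    linear_combination (-Complex.sinh s * Complex.sinh t) * huu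
  · simp only [boost, ofRow_a, mul_b, ofRow_b, Real.sinh_add, Complex.conj_ofReal]
    push_cast
    ring

theorem boost_inv_mul (u : ℂ) (hu : ‖u‖ = 1) (s t : ℝ) :
    (boost u hu s)⁻¹ * boost u hu t = boost u hu (t - s) := by
  rw [inv_mul_eq_iff_eq_mul, ← boost_add, add_sub_cancel]

end SU11

theorem tendsto_sinh_div_cosh :
    Filter.Tendsto (fun t : ℝ => Real.sinh t / Real.cosh t) Filter.atTop (𝓝 1) := by
  have h1 : Filter.Tendsto (fun t : ℝ => Real.exp (-t)) Filter.atTop (𝓝 0) :=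
    Real.tendsto_exp_neg_atTop_nhds_zero
  have h2 : Filter.Tendsto (fun t : ℝ => Real.exp (-t) / Real.cosh t) Filter.atTop (𝓝 0) :=
    squeeze_zero (fun t => by positivity) (fun t => div_le_self (Real.exp_pos _).le
      (Real.one_le_cosh t)) h1
  have h3 : (fun t : ℝ => Real.sinh t / Real.cosh t)
      = fun t => 1 - Real.exp (-t) / Real.cosh t := by
    funext t
    rw [eq_sub_iff_add_eq, ← add_div, div_eq_one_iff_eq (Real.cosh_pos t).ne',
      Real.sinh_eq, Real.cosh_eq]
    ring
  rw [h3]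
  simpa using h2.const_sub 1

-- Recurrence is applied to the boosts in direction `u`, with ever smaller neighbourhoods of the
-- identity. It returns elements `v⁻¹ * boost t * w` of `K` with `v`, `w` near 1 and `t` large;
-- after division by `cosh t` their rows tend to `(1, u)`.
open Filter in
theorem accumulatesAtBoundary_of_isInvariantOn {S : Subgroup GTilde}
    {μ : @Measure (GTilde ⧸ S) (borel (GTilde ⧸ S))} (hinv : IsInvariantOn S μ)
    (h0 : μ Set.univ ≠ 0) (htop : μ Set.univ ≠ ⊤) {K : Set SU11} (hK : ∀ g ∈ S, g.mat ∈ K) :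
    AccumulatesAtBoundary K := by
  intro u hu
  have main : ∀ n : ℕ, ∃ (v w : SU11) (t : ℝ), v⁻¹ * SU11.boost u hu t * w ∈ K ∧ (n : ℝ) ≤ t ∧
      (‖v.a - 1‖ < 1 / (n + 1) ∧ ‖v.b‖ < 1 / (n + 1)) ∧
      ‖w.a - 1‖ < 1 / (n + 1) ∧ ‖w.b‖ < 1 / (n + 1) := by
    intro n
    have hn : (0 : ℝ) < 1 / (n + 1) := by positivity
    have hV : {g : GTilde | ‖g.mat.a - 1‖ < 1 / (n + 1) ∧ ‖g.mat.b‖ < 1 / (n + 1)}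
        ∈ 𝓝 (1 : GTilde) := by
      have ha := SU11.continuous_a.comp GTilde.continuous_mat
      have hb := SU11.continuous_b.comp GTilde.continuous_mat
      refine IsOpen.mem_nhds ?_ ?_
      · exact (isOpen_lt ((ha.sub continuous_const).norm) continuous_const).inter
          (isOpen_lt hb.norm continuous_const)
      · simpa using hn
    -- With steps of length `n`, any two distinct indices are at least time `n` apart.
    choose b hb using fun i : ℕ => GTilde.exists_mat_eq (SU11.boost u hu (i * n))
    obtain ⟨i, j, hij, v, hv, w, hw, hS⟩ := exists_translates_meet hinv h0 htop hV b
    refine ⟨v.mat, w.mat, j * n - i * n, ?_, ?_, hv, hw⟩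
    · have := hK _ hS
      simpa [hb, SU11.boost_inv_mul] using this
    · have : (i : ℝ) + 1 ≤ j := by exact_mod_cast hij
      have hn0 : (0 : ℝ) ≤ n := n.cast_nonneg
      nlinarith
  choose v w t hk ht hv hw using main
  have hs : Tendsto (fun n : ℕ => (1 : ℝ) / (n + 1)) atTop (𝓝 0) :=
    tendsto_one_div_add_atTop_nhds_zero_nat
  have hva : Tendsto (fun n => (v n).a) atTop (𝓝 1) :=
    tendsto_iff_norm_sub_tendsto_zero.2
      (squeeze_zero (fun _ => norm_nonneg _) (fun n => (hv n).1.le) hs)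
  have hvb : Tendsto (fun n => (v n).b) atTop (𝓝 0) :=
    squeeze_zero_norm (fun n => (hv n).2.le) hs
  have hwa : Tendsto (fun n => (w n).a) atTop (𝓝 1) :=
    tendsto_iff_norm_sub_tendsto_zero.2
      (squeeze_zero (fun _ => norm_nonneg _) (fun n => (hw n).1.le) hs)
  have hwb : Tendsto (fun n => (w n).b) atTop (𝓝 0) :=
    squeeze_zero_norm (fun n => (hw n).2.le) hs
  have htt : Tendsto t atTop atTop := tendsto_atTop_mono ht tendsto_natCast_atTop_atTop
  have hτ : Tendsto (fun n => ((Real.sinh (t n) / Real.cosh (t n) : ℝ) : ℂ)) atTop (𝓝 1) := by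
    rw [← Complex.ofReal_one]
    exact (Complex.continuous_ofReal.tendsto 1).comp (tendsto_sinh_div_cosh.comp htt)
  have hall := (hva.prodMk_nhds hvb).prodMk_nhds ((hwa.prodMk_nhds hwb).prodMk_nhds hτ)
  refine ⟨fun n => (v n)⁻¹ * SU11.boost u hu (t n) * w n, fun n => Real.cosh (t n), hk, ?_, ?_⟩
  · have hc : Continuous fun q : (ℂ × ℂ) × (ℂ × ℂ) × ℂ =>
        (conj q.1.1 - q.1.2 * (q.2.2 * conj u)) * q.2.1.1
          + (conj q.1.1 * (q.2.2 * u) - q.1.2) * conj q.2.1.2 := by fun_prop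
    have h1 := (hc.tendsto ((1, 0), (1, 0), 1)).comp hall
    simp only [map_one, map_zero, mul_zero, zero_mul, sub_zero, mul_one, add_zero] at h1
    refine h1.congr fun n => ?_
    have hch : (Real.cosh (t n) : ℂ) ≠ 0 := by exact_mod_cast (Real.cosh_pos (t n)).ne'
    rw [eq_div_iff hch]
    simp only [Function.comp_apply, SU11.mul_a, SU11.mul_b, SU11.inv_a, SU11.inv_b, SU11.boost,
      SU11.ofRow_a, SU11.ofRow_b, map_mul, Complex.conj_ofReal, Complex.ofReal_div]
    field_simp
    ring
  · have hc : Continuous fun q : (ℂ × ℂ) × (ℂ × ℂ) × ℂ =>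
        (conj q.1.1 - q.1.2 * (q.2.2 * conj u)) * q.2.1.2
          + (conj q.1.1 * (q.2.2 * u) - q.1.2) * conj q.2.1.1 := by fun_prop
    have h1 := (hc.tendsto ((1, 0), (1, 0), 1)).comp hall
    simp only [map_one, zero_mul, sub_zero, mul_one, mul_zero, zero_add, one_mul] at h1
    refine h1.congr fun n => ?_
    have hch : (Real.cosh (t n) : ℂ) ≠ 0 := by exact_mod_cast (Real.cosh_pos (t n)).ne'
    rw [eq_div_iff hch]
    simp only [Function.comp_apply, SU11.mul_a, SU11.mul_b, SU11.inv_a, SU11.inv_b, SU11.boost,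
      SU11.ofRow_a, SU11.ofRow_b, map_mul, Complex.conj_ofReal, Complex.ofReal_div]
    field_simp
    ring

/-! ### The invariant norm of a differential -/

/-- The square of the hyperbolic norm of `F(z) (dz)^m`. -/
def hyperbolicNormSq (m : ℝ) (F : ℂ → ℂ) (z : ℂ) : ℝ := ‖F z‖ ^ 2 * (1 - ‖z‖ ^ 2) ^ (2 * m)

theorem differentiableAt_hyperbolicNormSq (m : ℝ) {F : ℂ → ℂ}
    (hF : DifferentiableOn ℂ F (Metric.ball 0 1)) (z : 𝔻) :
    DifferentiableAt ℝ (hyperbolicNormSq m F) z := by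
  have h1 : DifferentiableAt ℝ F z :=
    (hF.differentiableAt (Metric.isOpen_ball.mem_nhds (UnitDisc.coe_mem_ball z))).restrictScalars ℝ
  have h2 : DifferentiableAt ℝ (fun z : ℂ => 1 - ‖z‖ ^ 2) z :=
    (differentiableAt_const _).sub (differentiableAt_id.norm_sq ℝ)
  refine (h1.norm_sq ℝ).mul (h2.rpow_const (Or.inl ?_))
  have := z.sq_norm_lt_one
  linarith

theorem SU11.one_sub_norm_sq_inv_smul (g : SU11) (z : 𝔻) :
    1 - ‖((g⁻¹ • z : 𝔻) : ℂ)‖ ^ 2 = (1 - ‖(z : ℂ)‖ ^ 2) / ‖g.a - conj g.b * z‖ ^ 2 := by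
  have hd := (g⁻¹).den_ne_zero z
  simp only [inv_b, inv_a, map_neg, Complex.conj_conj] at hd
  have hd' : -conj g.b * (z : ℂ) + g.a = g.a - conj g.b * z := by ring
  rw [hd'] at hd
  have h0 : ‖g.a - conj g.b * (z : ℂ)‖ ≠ 0 := norm_ne_zero_iff.2 hd
  have key : ‖g.a - conj g.b * (z : ℂ)‖ ^ 2 - ‖conj g.a * z - g.b‖ ^ 2 = 1 - ‖(z : ℂ)‖ ^ 2 := by
    have h : ((‖g.a - conj g.b * (z : ℂ)‖ ^ 2 - ‖conj g.a * z - g.b‖ ^ 2 : ℝ) : ℂ)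
        = ((1 - ‖(z : ℂ)‖ ^ 2 : ℝ) : ℂ) := by
      push_cast
      simp only [← Complex.mul_conj', map_sub, map_mul, Complex.conj_conj]
      linear_combination (1 - (z : ℂ) * conj (z : ℂ)) * g.det_eq
    exact_mod_cast h
  rw [coe_smul]
  simp only [inv_b, inv_a, map_neg, Complex.conj_conj]
  rw [hd', ← sub_eq_add_neg, norm_div, div_pow, eq_div_iff (pow_ne_zero 2 h0), sub_mul,
    div_mul_cancel₀ _ (pow_ne_zero 2 h0), ← key]
  ring

/-- Since `m` is real, the modulus of the automorphy factor does not depend on the branch of the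
logarithm: it is `|a - conj b z|^(-2m)`, and the transformation of `1 - |z|²` compensates it. -/
theorem mat_mem_symmetryGroup (m : ℝ) {θ : Hol} {F : ℂ → ℂ} (hθ : ∀ z : 𝔻, θ.1 z = F z)
    {g : GTilde} (hg : g ∈ stab (rho m) θ) : g.mat ∈ symmetryGroup (hyperbolicNormSq m F) := by
  rw [← Subgroup.inv_mem_iff]
  intro z
  have h1 : rho m g θ = θ := hg
  have h2 : θ.1 (g.mat⁻¹ • z) * Complex.exp (-2 * m * g.logDen z) = θ.1 z :=
    congrArg (fun f : Hol => f.1 z) h1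
  have hx : ‖Complex.exp (g.logDen z)‖ = ‖g.mat.a - conj g.mat.b * z‖ := by rw [g.exp_logDen]
  have hpos : 0 < ‖g.mat.a - conj g.mat.b * (z : ℂ)‖ := by
    rw [← hx]; exact norm_pos_iff.2 (Complex.exp_ne_zero _)
  have hz := z.sq_norm_lt_one
  unfold hyperbolicNormSq
  rw [← hθ, ← hθ, ← h2, SU11.one_sub_norm_sq_inv_smul, norm_mul, mul_pow, mul_assoc]
  congr 1
  rw [Real.div_rpow (by linarith) (by positivity), div_eq_mul_inv, mul_comm]
  congr 1
  have h3 : -2 * (m : ℂ) * g.logDen z = ((-2 * m : ℝ) : ℂ) * g.logDen z := by push_cast; ring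
  rw [Complex.norm_exp, h3, Complex.re_ofReal_mul]
  rw [Complex.norm_exp] at hx
  rw [← hx, ← Real.exp_nat_mul, ← Real.exp_nat_mul, ← Real.exp_mul, ← Real.exp_neg]
  congr 1
  push_cast
  ring

/-- A constant norm would make `F` zero-free with `|1/F|² = (1 - |z|²)^(2m) / c`. For `m > 0` this
is larger at the centre than on a circle around it, against the maximum principle. -/
theorem hyperbolicNormSq_not_const {m : ℝ} (hm : 0 < m) {F : ℂ → ℂ}
    (hF : DifferentiableOn ℂ F (Metric.ball 0 1)) (hne : ∃ z : 𝔻, F z ≠ 0) {c : ℝ}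
    (hc : ∀ z : 𝔻, hyperbolicNormSq m F z = c) : False := by
  have hpos : ∀ z : 𝔻, 0 < (1 - ‖(z : ℂ)‖ ^ 2) ^ (2 * m) := fun z =>
    Real.rpow_pos_of_pos (by have := z.sq_norm_lt_one; linarith) _
  have hc0 : 0 < c := by
    obtain ⟨z, hz⟩ := hne
    rw [← hc z]
    exact mul_pos (pow_pos (norm_pos_iff.2 hz) 2) (hpos z)
  have hFz : ∀ z : 𝔻, F z ≠ 0 := fun z hz => by
    have := hc z
    rw [hyperbolicNormSq, hz] at this
    simp at this
    linarith
  have hnorm : ∀ z : 𝔻, ‖(F z)⁻¹‖ ^ 2 = (1 - ‖(z : ℂ)‖ ^ 2) ^ (2 * m) / c := fun z => by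
    have h1 := hc z
    have h2 : ‖F z‖ ≠ 0 := norm_ne_zero_iff.2 (hFz z)
    rw [hyperbolicNormSq] at h1
    rw [norm_inv, eq_div_iff hc0.ne', ← h1]
    field_simp
  have hd : DiffContOnCl ℂ (fun z => (F z)⁻¹) (Metric.ball 0 (1 / 2)) := by
    refine DifferentiableOn.diffContOnCl ?_
    refine (hF.mono ?_).inv ?_
    · refine Metric.closure_ball_subset_closedBall.trans (Metric.closedBall_subset_ball (by norm_num))
    · intro z hz
      have hz' : z ∈ Metric.ball (0 : ℂ) 1 :=
        Metric.closedBall_subset_ball (by norm_num) (Metric.closure_ball_subset_closedBall hz)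
      obtain ⟨w, rfl⟩ := UnitDisc.exists_coe_eq hz'
      exact hFz w
  -- The value of `|1/F|` on the circle `|z| = 1/2`, where `1 - |z|² = 3/4`.
  set C := Real.sqrt ((3 / 4 : ℝ) ^ (2 * m) / c) with hC
  have hle : ‖(F 0)⁻¹‖ ≤ C := by
    refine Complex.norm_le_of_forall_mem_frontier_norm_le Metric.isBounded_ball hd ?_
      (subset_closure (Metric.mem_ball_self (by norm_num)))
    intro z hz
    rw [frontier_ball _ (by norm_num), mem_sphere_zero_iff_norm] at hz
    have hz' : z ∈ Metric.ball (0 : ℂ) 1 := by rw [mem_ball_zero_iff, hz]; norm_num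
    obtain ⟨w, rfl⟩ := UnitDisc.exists_coe_eq hz'
    refine Real.le_sqrt_of_sq_le ?_
    rw [hnorm w, hz]
    norm_num
  have h0 := hnorm 0
  rw [Complex.UnitDisc.coe_zero] at h0
  have h1 : ‖(F 0)⁻¹‖ ^ 2 ≤ (3 / 4 : ℝ) ^ (2 * m) / c := by
    rw [← Real.sq_sqrt (show 0 ≤ (3 / 4 : ℝ) ^ (2 * m) / c by positivity)]
    exact pow_le_pow_left₀ (norm_nonneg _) hle 2
  rw [h0, div_le_div_iff_of_pos_right hc0] at h1
  simp at h1
  have h2 : (3 / 4 : ℝ) ^ (2 * m) < 1 :=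
    Real.rpow_lt_one (by norm_num) (by norm_num) (by linarith)
  linarith

/-- Nontrivial symmetries arbitrarily close to the identity would give an annihilating Killing
field, hence a vanishing differential and a constant norm on the connected disc. -/
theorem exists_nhds_inter_symmetryGroup {m : ℝ} (hm : 0 < m) {F : ℂ → ℂ}
    (hF : DifferentiableOn ℂ F (Metric.ball 0 1)) (hne : ∃ z : 𝔻, F z ≠ 0)
    (hK : AccumulatesAtBoundary (symmetryGroup (hyperbolicNormSq m F))) :
    ∃ W ∈ 𝓝 (1 : SU11), ∀ g ∈ W, g ∈ symmetryGroup (hyperbolicNormSq m F) → g = 1 := by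
  have hd := differentiableAt_hyperbolicNormSq m hF
  by_contra! hW
  have hfreq : ∃ᶠ g in 𝓝 (1 : SU11),
      g ∈ symmetryGroup (hyperbolicNormSq m F) ∧ g ≠ 1 ∧ 0 < g.a.re := by
    rw [Filter.frequently_iff]
    intro U hU
    have h1 : {g : SU11 | 0 < g.a.re} ∈ 𝓝 (1 : SU11) :=
      (isOpen_lt continuous_const (Complex.continuous_re.comp SU11.continuous_a)).mem_nhds
        (by simp)
    obtain ⟨g, hg, hgK, hg1⟩ := hW (U ∩ {g | 0 < g.a.re}) (Filter.inter_mem hU h1)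
    exact ⟨g, hg.1, hgK, hg1, hg.2⟩
  obtain ⟨g, hlim, hg⟩ := Filter.exists_seq_forall_of_frequently hfreq
  obtain ⟨β, α, h0, hβ⟩ := exists_isAnnihilated_of_tendsto_one hd (fun n => (hg n).1) hlim
    (fun n => (hg n).2.1) (fun n => (hg n).2.2)
  have hz := fderiv_eq_zero_of_isAnnihilated hd hK h0 hβ
  obtain ⟨c, hc⟩ := Metric.isOpen_ball.exists_is_const_of_fderiv_eq_zero
    (convex_ball (0 : ℂ) 1).isPreconnected (f := hyperbolicNormSq m F) (𝕜 := ℝ)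
    (fun z hz => by
      obtain ⟨w, rfl⟩ := UnitDisc.exists_coe_eq hz
      exact (hd w).differentiableWithinAt)
    (fun z hz' => by
      obtain ⟨w, rfl⟩ := UnitDisc.exists_coe_eq hz'
      exact hz w)
  exact hyperbolicNormSq_not_const hm hF hne fun z => hc z (UnitDisc.coe_mem_ball z)


/-! ### The stability subgroup and the centre -/

theorem negOne_mem_symmetryGroup (h : ℂ → ℝ) : SU11.negOne ∈ symmetryGroup h := fun z => by
  rw [SU11.negOne_smul]

theorem center_zpow_mat_mem_symmetryGroup (h : ℂ → ℝ) (k : ℤ) :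
    (GTilde.center ^ k).mat ∈ symmetryGroup h := by
  rw [GTilde.mat_center_zpow]
  exact Subgroup.zpow_mem _ (negOne_mem_symmetryGroup h) k

theorem exists_nhds_one_inv_mul {Γ : Type*} [Group Γ] [TopologicalSpace Γ] [IsTopologicalGroup Γ]
    {U : Set Γ} (hU : U ∈ 𝓝 (1 : Γ)) : ∃ V ∈ 𝓝 (1 : Γ), ∀ v ∈ V, ∀ w ∈ V, v⁻¹ * w ∈ U := by
  obtain ⟨V, hV, hVU⟩ := exists_nhds_split_inv hU
  refine ⟨V⁻¹, inv_mem_nhds_one Γ hV, fun v hv w hw => ?_⟩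
  have := hVU v⁻¹ hv w⁻¹ hw
  rwa [div_inv_eq_mul] at this

/-- Recurrence along the powers of `center` puts `center ^ (j - i) * (v⁻¹ * w)` into `S` with `v⁻¹ *
w` close to 1. Central elements act trivially on the disc, so the matrix of `v⁻¹ * w` is itself a
symmetry near 1, hence trivial, and only the central power is left. -/
theorem exists_center_pow_mem {S : Subgroup GTilde}
    {μ : @Measure (GTilde ⧸ S) (borel (GTilde ⧸ S))} (hinv : IsInvariantOn S μ)
    (h0 : μ Set.univ ≠ 0) (htop : μ Set.univ ≠ ⊤) {h : ℂ → ℝ}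
    (hS : ∀ g ∈ S, g.mat ∈ symmetryGroup h) {W : Set SU11} (hW : W ∈ 𝓝 (1 : SU11))
    (hW1 : ∀ g ∈ W, g ∈ symmetryGroup h → g = 1) :
    ∃ n : ℕ, 0 < n ∧ GTilde.center ^ n ∈ S := by
  have hU : {g : GTilde | g.mat ∈ W ∧ ‖g.A‖ < 1} ∈ 𝓝 (1 : GTilde) := by
    refine Filter.inter_mem (GTilde.continuous_mat.continuousAt.preimage_mem_nhds hW) ?_
    exact (isOpen_lt GTilde.continuous_A.norm continuous_const).mem_nhds (by simp)
  obtain ⟨V, hV, hVU⟩ := exists_nhds_one_inv_mul hU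
  obtain ⟨i, j, hij, v, hv, w, hw, hs⟩ := exists_translates_meet hinv h0 htop hV
    (fun i => GTilde.center ^ i)
  obtain ⟨hgW, hgA⟩ := hVU v hv w hw
  have hij' : (GTilde.center ^ i)⁻¹ * GTilde.center ^ j = GTilde.center ^ (j - i) := by
    rw [pow_sub _ hij.le, ((GTilde.center_comm _).pow_left j).eq]
  have hs' : GTilde.center ^ (j - i) * (v⁻¹ * w) ∈ S := by
    rwa [← mul_assoc, ((GTilde.center_comm v⁻¹).pow_left (j - i)).eq, ← hij']
  have hmat : (v⁻¹ * w).mat = 1 := by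
    refine hW1 _ hgW ?_
    have h1 := hS _ hs'
    rw [GTilde.mat_mul, ← zpow_natCast] at h1
    exact ((symmetryGroup h).mul_mem_cancel_left (center_zpow_mat_mem_symmetryGroup h _)).1 h1
  have hA : (v⁻¹ * w).A = 0 := by
    -- The logarithm is smaller than 1 in norm, so among the values in `2πi ℤ` it can only be zero.
    refine eq_of_exp_eq ?_ ?_
    · rw [GTilde.exp_A, hmat]; simp
    · have := Complex.abs_im_le_norm (v⁻¹ * w).A
      have hpi := Real.pi_gt_three
      simp only [Complex.zero_im, sub_zero]
      linarith
  have h1 : v⁻¹ * w = 1 := GTilde.ext' hmat hA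
  rw [h1, mul_one] at hs'
  exact ⟨j - i, Nat.sub_pos_of_lt hij, hs'⟩

theorem exists_ne_zero_of_ne_zero {θ : Hol} (hθ : θ ≠ 0) : ∃ z : 𝔻, θ.1 z ≠ 0 := by
  by_contra! h
  exact hθ (Subtype.ext (ContinuousMap.ext h))

/-- A central power acts by the scalar `exp(-2πi n m)`, which must be 1 if it fixes a nonzero
differential. -/
theorem exists_int_of_center_pow_mem {m : ℝ} {θ : Hol} (hθ : θ ≠ 0) {n : ℕ}
    (hn : GTilde.center ^ n ∈ stab (rho m) θ) : ∃ l : ℤ, n * m = l := by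
  obtain ⟨z, hz⟩ := exists_ne_zero_of_ne_zero hθ
  have h1 : rho m (GTilde.center ^ n) θ = θ := hn
  have h2 := rho_center_pow m n θ z
  rw [h1] at h2
  have h3 : Complex.exp (n * (-2 * m * (Complex.I * Real.pi))) = 1 :=
    mul_right_cancel₀ hz (by rw [← h2, one_mul])
  obtain ⟨l, hl⟩ := Complex.exp_eq_one_iff.1 h3
  refine ⟨-l, ?_⟩
  have hpi : (Real.pi : ℂ) ≠ 0 := by exact_mod_cast Real.pi_ne_zero
  have h4 : (n * m : ℂ) = ((-l : ℤ) : ℂ) := by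
    refine mul_right_cancel₀ (mul_ne_zero (mul_ne_zero two_ne_zero hpi) Complex.I_ne_zero) ?_
    push_cast
    linear_combination -hl
  exact_mod_cast h4

theorem exists_int_of_center_zpow_mem {m : ℝ} {θ : Hol} (hθ : θ ≠ 0) {k : ℤ}
    (hk : GTilde.center ^ k ∈ stab (rho m) θ) : ∃ l : ℤ, k * m = l := by
  obtain ⟨n, rfl | rfl⟩ := k.eq_nat_or_neg
  · rw [zpow_natCast] at hk
    exact_mod_cast exists_int_of_center_pow_mem hθ hk
  · rw [zpow_neg, Subgroup.inv_mem_iff, zpow_natCast] at hk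
    obtain ⟨l, hl⟩ := exists_int_of_center_pow_mem hθ hk
    exact ⟨-l, by push_cast; linarith⟩

theorem exists_coprime_of_mul_eq_int {m : ℝ} (hm : 0 < m) {n : ℕ} (hn : 0 < n) {l : ℤ}
    (h : n * m = l) : ∃ M N : ℕ, 0 < M ∧ 0 < N ∧ M.Coprime N ∧ m = (M : ℝ) / N := by
  have hn' : (n : ℝ) ≠ 0 := by exact_mod_cast hn.ne'
  obtain ⟨q, hq⟩ : ∃ q : ℚ, (q : ℝ) = m := ⟨l / n, by push_cast; field_simp; linarith⟩
  have hq0 : 0 < q := by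
    have : (0 : ℝ) < q := by rw [hq]; exact hm
    exact_mod_cast this
  have hnum := Rat.num_pos.2 hq0
  refine ⟨q.num.natAbs, q.den, Int.natAbs_pos.2 hnum.ne', q.pos, q.reduced, ?_⟩
  rw [← hq, Nat.cast_natAbs, abs_of_pos hnum]
  exact Rat.cast_def q

/-- The product `k M / N` is an integer with `M` prime to `N`. This controls how far two lifts of
the same element of `PSU(1,1)` can differ inside the stabilizer. -/
theorem dvd_of_center_zpow_mem {M N : ℕ} (hN : 0 < N) (hMN : M.Coprime N) {θ : Hol} (hθ : θ ≠ 0)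
    {k : ℤ} (hk : GTilde.center ^ k ∈ stab (rho ((M : ℝ) / N)) θ) : (N : ℤ) ∣ k := by
  obtain ⟨l, hl⟩ := exists_int_of_center_zpow_mem hθ hk
  have hN' : (N : ℝ) ≠ 0 := by exact_mod_cast hN.ne'
  have h1 : k * M = l * N := by
    rw [mul_div_assoc', div_eq_iff hN'] at hl
    exact_mod_cast hl
  have h2 : (N : ℤ) ∣ k * M := ⟨l, by rw [h1, mul_comm]⟩
  exact (Nat.isCoprime_iff_coprime.2 hMN.symm).dvd_of_dvd_mul_right h2

theorem mk_mem_stab_rhoCover {M N : ℕ} {θ : Hol} (g : GTilde) :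
    (QuotientGroup.mk g : GCover N) ∈ stab (rhoCover M N) θ
      ↔ g ∈ stab (rho ((M : ℝ) / N)) θ := Iff.rfl

theorem mk_eq_of_toPSU_eq {M N : ℕ} (hN : 0 < N) (hMN : M.Coprime N) {θ : Hol} (hθ : θ ≠ 0)
    {g h : GTilde} (hg : g ∈ stab (rho ((M : ℝ) / N)) θ) (hh : h ∈ stab (rho ((M : ℝ) / N)) θ)
    (hgh : g.toPSU = h.toPSU) : ∃ k : ℤ, h = g * GTilde.center ^ (N * k : ℤ) := by
  obtain ⟨k, hk⟩ := GTilde.toPSU_eq_one (g := g⁻¹ * h) (by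
    rw [map_mul, map_inv, hgh, inv_mul_cancel])
  have hmem : GTilde.center ^ k ∈ stab (rho ((M : ℝ) / N)) θ := by
    rw [← hk]; exact mul_mem (inv_mem hg) hh
  obtain ⟨j, rfl⟩ := dvd_of_center_zpow_mem hN hMN hθ hmem
  exact ⟨j, by rw [← hk, mul_inv_cancel_left]⟩

theorem injOn_toPSU {M N : ℕ} (hN : 0 < N) (hMN : M.Coprime N) {θ : Hol} (hθ : θ ≠ 0) :
    Set.InjOn (GCover.toPSU N) (stab (rhoCover M N) θ) := by
  intro x hx y hy hxy
  obtain ⟨g, rfl⟩ := QuotientGroup.mk_surjective x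
  obtain ⟨h, rfl⟩ := QuotientGroup.mk_surjective y
  obtain ⟨k, rfl⟩ := mk_eq_of_toPSU_eq hN hMN hθ (mk_mem_stab_rhoCover g |>.1 hx)
    (mk_mem_stab_rhoCover h |>.1 hy) hxy
  rw [QuotientGroup.eq, inv_mul_cancel_left, zpow_mul, zpow_natCast]
  exact Subgroup.zpow_mem _ (Subgroup.mem_zpowers _) k

/-! ### Passage to the covering groups of finite degree -/

theorem continuous_orbitMap_rhoCover (M N : ℕ) (θ : Hol) :
    Continuous (orbitMap (rhoCover M N) θ) := by
  refine continuous_quot_lift _ ?_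
  exact QuotientGroup.isOpenQuotientMap_mk.isQuotientMap.continuous_iff.2 (continuous_rho_apply ((M : ℝ) / N) θ)

/-- The orbit map of the universal covering group factors through that of the `N`-fold cover, so the
invariant measure can be pushed forward without changing `ν` or the total mass. -/
theorem isNormalizedOrbitVolume_rhoCover {M N : ℕ} {θ : Hol} {ν : Measure Hol}
    (h : IsNormalizedOrbitVolume (rho ((M : ℝ) / N)) θ ν) :
    IsNormalizedOrbitVolume (rhoCover M N) θ ν := by
  obtain ⟨μ, hinv, h0, htop, hν⟩ := h
  have hle : stab (rho ((M : ℝ) / N)) θ ≤ (stab (rhoCover M N) θ).comap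
      (QuotientGroup.mk' (Subgroup.zpowers (GTilde.center ^ N))) := fun g hg => hg
  have hφ : Continuous (QuotientGroup.mk' (Subgroup.zpowers (GTilde.center ^ N))) :=
    QuotientGroup.continuous_mk
  have huniv := pushCoset_univ hφ hle μ
  refine ⟨pushCoset _ hle μ,
    isInvariantOn_pushCoset hφ (QuotientGroup.mk'_surjective _) hle hinv, ?_, ?_, ?_⟩
  · exact huniv.trans_ne h0
  · exact huniv.trans_ne htop
  · rw [hν]
    refine congrArg₂ (· • ·) (congrArg _ huniv.symm) ?_
    let _ : MeasurableSpace (GTilde ⧸ stab (rho ((M : ℝ) / N)) θ) := borel _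
    have : BorelSpace (GTilde ⧸ stab (rho ((M : ℝ) / N)) θ) := ⟨rfl⟩
    let _ : MeasurableSpace (GCover N ⧸ stab (rhoCover M N) θ) := borel _
    have : BorelSpace (GCover N ⧸ stab (rhoCover M N) θ) := ⟨rfl⟩
    have hm := (continuous_orbitMap_rhoCover M N θ).measurable
    have hm' := (continuous_cosetMap hφ hle).measurable
    refine Eq.trans ?_ (Measure.map_map hm hm').symm
    congr 1
    funext x
    obtain ⟨g, rfl⟩ := QuotientGroup.mk_surjective x
    rfl

theorem eq_dirac_of_isNormalizedOrbitVolume_zero {m : ℝ} {ν : Measure Hol}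
    (h : IsNormalizedOrbitVolume (rho m) 0 ν) : ν = Measure.dirac 0 := by
  obtain ⟨μ, -, h0, htop, hν⟩ := h
  let _ : MeasurableSpace (GTilde ⧸ stab (rho m) 0) := borel _
  have hconst : orbitMap (rho m) (0 : Hol) = fun _ => 0 := by
    funext x
    obtain ⟨g, rfl⟩ := QuotientGroup.mk_surjective x
    refine Subtype.ext (ContinuousMap.ext fun z => ?_)
    exact zero_mul _
  rw [hν, hconst, Measure.map_const, smul_smul, ENNReal.inv_mul_cancel h0 htop, one_smul]

theorem discreteTopology_of_mk_mem {L : Subgroup PSU11} {W : Set SU11} (hW : W ∈ 𝓝 (1 : SU11))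
    (h : ∀ g ∈ W, (QuotientGroup.mk g : PSU11) ∈ L → g = 1) : DiscreteTopology L := by
  have hW' : (QuotientGroup.mk : SU11 → PSU11) '' W ∈ 𝓝 (1 : PSU11) :=
    QuotientGroup.isOpenMap_coe.image_mem_nhds hW
  refine discreteTopology_of_nhds hW' ?_
  rintro _ ⟨g, hg, rfl⟩ hL
  rw [h g hg hL]; rfl

/-! ### The induced root of the canonical bundle -/

theorem GTilde.logDen_center_zpow_mul (k : ℤ) (g : GTilde) (z : 𝔻) :
    (GTilde.center ^ k * g).logDen z = k * (Complex.I * Real.pi) + g.logDen z := by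
  have h1 : ((GTilde.center ^ k).mat⁻¹ • z : 𝔻) = z := by
    rw [inv_smul_eq_iff]
    rcases mem_zpowers_negOne (g := (GTilde.center ^ k).mat)
      (by rw [mat_center_zpow]; exact ⟨k, rfl⟩) with h | h
    · rw [h, one_smul]
    · rw [h, SU11.negOne_smul]
  have h2 : (GTilde.center ^ k).mat.b = 0 := by
    rcases mem_zpowers_negOne (g := (GTilde.center ^ k).mat)
      (by rw [mat_center_zpow]; exact ⟨k, rfl⟩) with h | h <;> simp [h]
  rw [GTilde.logDen_mul, h1]
  congr 1
  simp [GTilde.logDen, h2, GTilde.A_center_zpow]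

/-- Two lifts in the stabilizer differ by `center ^ (N * k)`. This shifts the logarithm by a
multiple of `iπN`, and its product with `2/N` by a multiple of `2πi`. -/
theorem exp_logDen_eq_of_toPSU_eq {M N : ℕ} (hN : 0 < N) (hMN : M.Coprime N) {θ : Hol}
    (hθ : θ ≠ 0) {g h : GTilde} (hg : g ∈ stab (rho ((M : ℝ) / N)) θ)
    (hh : h ∈ stab (rho ((M : ℝ) / N)) θ) (hgh : g.toPSU = h.toPSU) (z : 𝔻) :
    Complex.exp (2 / N * (h⁻¹).logDen z) = Complex.exp (2 / N * (g⁻¹).logDen z) := by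
  obtain ⟨k, rfl⟩ := mk_eq_of_toPSU_eq hN hMN hθ hg hh hgh
  have hN' : (N : ℂ) ≠ 0 := by exact_mod_cast hN.ne'
  rw [mul_inv_rev, ← zpow_neg, GTilde.logDen_center_zpow_mul, mul_add, Complex.exp_add]
  have h1 : (2 / N * (((-(N * k) : ℤ) : ℂ) * (Complex.I * Real.pi)) : ℂ)
      = ((-k : ℤ) : ℂ) * (2 * Real.pi * Complex.I) := by
    push_cast; field_simp
  rw [h1, Complex.exp_int_mul_two_pi_mul_I, one_mul]

theorem deriv_moebius (g : SU11) (z : 𝔻) :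
    deriv (moebius (QuotientGroup.mk g)) z = 1 / (conj g.b * z + conj g.a) ^ 2 := by
  have h : moebius (QuotientGroup.mk g)
      =ᶠ[𝓝 (z : ℂ)] fun w : ℂ => (g.a * w + g.b) / (conj g.b * w + conj g.a) := by
    filter_upwards [Metric.isOpen_ball.mem_nhds (UnitDisc.coe_mem_ball z)] with w hw
    rw [moebius, dif_pos (mem_ball_zero_iff.1 hw)]
    rfl
  rw [h.deriv_eq, (g.hasDerivAt_smul z).deriv]

theorem coe_smul_of_mem {L : Subgroup PSU11} {l : L} {g : GTilde} (h : g.toPSU = l) (z : 𝔻) :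
    l • z = g.mat • z := by
  change (l : PSU11) • z = _
  rw [← h]; rfl

theorem GTilde.logDen_inv_mul (g h : GTilde) (z : 𝔻) :
    ((g * h)⁻¹).logDen z = (h⁻¹).logDen z + (g⁻¹).logDen (h.mat • z : 𝔻) := by
  rw [mul_inv_rev, GTilde.logDen_mul, GTilde.mat_inv, inv_inv]

theorem exists_stab_lift {M N : ℕ} {θ : Hol}
    (l : (stab (rhoCover M N) θ).map (GCover.toPSU N)) :
    ∃ g : GTilde, g ∈ stab (rho ((M : ℝ) / N)) θ ∧ g.toPSU = l := by
  obtain ⟨x, hx, hxl⟩ := l.2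
  obtain ⟨g, rfl⟩ := QuotientGroup.mk_surjective x
  exact ⟨g, hx, hxl⟩

/-- The root of the canonical bundle of `L \ 𝔻` defined by the stability subgroup of `θ`. -/
def inducedRoot {M N : ℕ} (hN : 0 < N) (hMN : M.Coprime N) {θ : Hol} (hθ : θ ≠ 0) :
    CanonicalRoot ((stab (rhoCover M N) θ).map (GCover.toPSU N)) N where
  -- The chosen lift is immaterial by `exp_logDen_eq_of_toPSU_eq`; the cocycle identities are
  -- therefore checked on convenient lifts.
  factor l z := Complex.exp (2 / N * ((exists_stab_lift l).choose⁻¹).logDen z)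
  factor_one z := by
    have h := (exists_stab_lift (1 : (stab (rhoCover M N) θ).map (GCover.toPSU N))).choose_spec
    rw [exp_logDen_eq_of_toPSU_eq hN hMN hθ (one_mem _) h.1 (by rw [h.2, map_one]; rfl), inv_one,
      GTilde.logDen_one, mul_zero, Complex.exp_zero]
  factor_mul g h z := by
    have h1 := (exists_stab_lift g).choose_spec
    have h2 := (exists_stab_lift h).choose_spec
    have h3 := (exists_stab_lift (g * h)).choose_spec
    rw [exp_logDen_eq_of_toPSU_eq hN hMN hθ (mul_mem h1.1 h2.1) h3.1
      (by rw [h3.2, map_mul, h1.2, h2.2]; rfl), GTilde.logDen_inv_mul, coe_smul_of_mem h2.2,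
      mul_add, Complex.exp_add, mul_comm]
  holomorphic g := ⟨fun z => Complex.exp (2 / N * ((exists_stab_lift g).choose⁻¹).logDen z),
    ((differentiableOn_logDen _).const_mul _).cexp, fun _ => rfl⟩
  factor_pow l z := by
    have h := (exists_stab_lift l).choose_spec
    generalize (exists_stab_lift l).choose = g at h
    have hN' : (N : ℂ) ≠ 0 := by exact_mod_cast hN.ne'
    have h1 : (l : PSU11) = QuotientGroup.mk g.mat := h.2.symm
    rw [h1, deriv_moebius, ← Complex.exp_nat_mul]
    have h2 : (N : ℂ) * (2 / N * (g⁻¹).logDen z) = (2 : ℕ) * (g⁻¹).logDen z := by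
      field_simp; push_cast; ring
    rw [h2, Complex.exp_nat_mul, GTilde.exp_logDen]
    simp only [GTilde.mat_inv, SU11.inv_a, SU11.inv_b, map_neg, one_div, inv_inv]
    ring

theorem inducedRoot_factor {M N : ℕ} (hN : 0 < N) (hMN : M.Coprime N) {θ : Hol} (hθ : θ ≠ 0)
    (l : (stab (rhoCover M N) θ).map (GCover.toPSU N)) {g : GTilde}
    (hg : g ∈ stab (rho ((M : ℝ) / N)) θ) (hl : g.toPSU = l) (z : 𝔻) :
    (inducedRoot hN hMN hθ).factor l z = Complex.exp (2 / N * (g⁻¹).logDen z) := by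
  have h := (exists_stab_lift l).choose_spec
  exact exp_logDen_eq_of_toPSU_eq hN hMN hθ hg h.1 (by rw [h.2, hl]) z

/-- Invariance of `θ` under the inverse of a lift: the exponent `-2M/N` of the action cancels
against the `M`-th power of the factor. This is what lets `θ` descend to a section. -/
theorem apply_smul_eq {M N : ℕ} (hN : 0 < N) (hMN : M.Coprime N) {θ : Hol} (hθ : θ ≠ 0)
    (l : (stab (rhoCover M N) θ).map (GCover.toPSU N)) (z : 𝔻) :
    θ.1 (l • z) = (inducedRoot hN hMN hθ).factor l z ^ M * θ.1 z := by
  obtain ⟨g, hg, hl⟩ := exists_stab_lift l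
  have h1 : rho ((M : ℝ) / N) g⁻¹ θ = θ := (stab (rho ((M : ℝ) / N)) θ).inv_mem hg
  have h2 : θ.1 ((g⁻¹).mat⁻¹ • z) * Complex.exp (-2 * ((M / N : ℝ) : ℂ) * (g⁻¹).logDen z)
      = θ.1 z := congrArg (fun f : Hol => f.1 z) h1
  rw [inducedRoot_factor hN hMN hθ l hg hl, coe_smul_of_mem hl, ← h2, ← Complex.exp_nat_mul,
    mul_left_comm, ← Complex.exp_add, GTilde.mat_inv, inv_inv]
  have h3 : (M : ℂ) * (2 / N * (g⁻¹).logDen z) + -2 * ((M / N : ℝ) : ℂ) * (g⁻¹).logDen z = 0 := by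
    push_cast; ring
  rw [h3, Complex.exp_zero, mul_one]

/-- The differential on `L \ 𝔻` whose pullback is `θ`. -/
def inducedDifferential {M N : ℕ} (hN : 0 < N) (hMN : M.Coprime N) {θ : Hol} (hθ : θ ≠ 0) :
    (inducedRoot hN hMN hθ).Differential M where
  toFun := Quotient.lift (fun z : 𝔻 => (inducedRoot hN hMN hθ).vec M z (θ.1 z)) <| by
    rintro z w ⟨l, rfl⟩
    have h : (inducedRoot hN hMN hθ).setoid M (w, θ.1 w) (l • w, θ.1 (l • w)) :=
      ⟨l, Prod.ext rfl (apply_smul_eq hN hMN hθ l w)⟩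
    exact (Quotient.sound h).symm
  isSection x := by
    induction x using Quotient.inductionOn with
    | h z => rfl
  holomorphic z₀ := by
    obtain ⟨F, hF, hθF⟩ := θ.2
    refine ⟨Metric.ball 0 1, Metric.isOpen_ball, UnitDisc.coe_mem_ball z₀, F, hF, fun z _ => ?_⟩
    rw [← hθF]
    rfl


/-! ### Unimodularity of `SU(1,1)` -/

namespace SU11

theorem isCompact_norm_b_le (C : ℝ) : IsCompact {g : SU11 | ‖g.b‖ ≤ C} := by
  have h1 : {g : SU11 | ‖g.b‖ ≤ C}
      = (fun g : SU11 => (g.a, g.b)) ⁻¹' (Metric.closedBall 0 (1 + |C|) ×ˢ Metric.closedBall 0 C) := by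
    ext g
    simp only [Set.mem_ofPred_eq, Set.mem_preimage, Set.mem_prod, mem_closedBall_zero_iff,
      iff_and_self]
    intro hb
    have h2 := g.norm_sq_eq
    have h3 := le_abs_self C
    nlinarith [norm_nonneg g.a, norm_nonneg g.b, abs_nonneg C]
  rw [h1]
  exact isClosedEmbedding_row.isCompact_preimage
    ((isCompact_closedBall _ _).prod (isCompact_closedBall _ _))

-- Right multiplication by a diagonal element preserves `|b|`, hence preserves a compact set of
-- positive Haar measure, so it cannot rescale the measure.
open Measure in
theorem modularCharacterFun_eq_one_of_b_eq_zero {k : SU11} (hk : k.b = 0) :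
    modularCharacterFun k = 1 := by
  borelize SU11
  have hka : ‖k.a‖ = 1 := by
    have := k.norm_sq_eq
    rw [hk, norm_zero] at this
    nlinarith [norm_nonneg k.a]
  set E : Set SU11 := {g | ‖g.b‖ ≤ 1} with hE
  have hEc : IsCompact E := isCompact_norm_b_le 1
  have hfin : (haar : Measure SU11) E ≠ ⊤ := hEc.measure_lt_top.ne
  have hpos : (haar : Measure SU11) E ≠ 0 := by
    refine (measure_pos_of_mem_nhds haar (x := (1 : SU11)) ?_).ne'
    refine Filter.mem_of_superset ((isOpen_lt continuous_b.norm continuous_const).mem_nhds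
      (show ‖(1 : SU11).b‖ < 1 by simp)) ?_
    intro g hg
    exact (show ‖g.b‖ < 1 from hg).le
  have h1 := congrArg (fun μ : Measure SU11 => μ E)
    (map_right_mul_eq_modularCharacterFun_smul (haar : Measure SU11) k)
  have h2 : (fun g : SU11 => g * k) ⁻¹' E = E := by
    ext g
    simp [hE, mul_b, hk, hka]
  simp only [Measure.smul_apply] at h1
  rw [Measure.map_apply (measurable_mul_const k) hEc.measurableSet, h2, ENNReal.smul_def,
    smul_eq_mul] at h1
  have h3 : (modularCharacterFun k : ENNReal) = 1 := by
    refine (ENNReal.mul_left_inj hpos hfin).1 ?_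
    rw [one_mul, ← h1]
  exact_mod_cast h3

-- Conjugation by `diag(i, -i)` inverts an element with real `a`. The modular character then takes
-- the same value on `p` and `p⁻¹`, so its square is 1, and it is nonnegative.
open Measure in
theorem modularCharacterFun_eq_one_of_conj_a {p : SU11} (hp : conj p.a = p.a) :
    modularCharacterFun p = 1 := by
  let J : SU11 := ofRow Complex.I 0 (by simp)
  have h1 : J * p * J⁻¹ = p⁻¹ := by
    apply ext'
    · simp only [J, mul_a, mul_b, ofRow_a, ofRow_b, inv_a, inv_b, Complex.conj_I, hp, map_zero,
        neg_zero, mul_zero, zero_mul, add_zero]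
      linear_combination -p.a * Complex.I_sq
    · simp only [J, mul_a, mul_b, ofRow_a, ofRow_b, inv_a, inv_b, Complex.conj_I, hp, map_neg,
        neg_zero, mul_zero, zero_mul, add_zero, zero_add]
      linear_combination p.b * Complex.I_sq
  have h2 := congrArg modularCharacter h1
  rw [map_mul, map_mul, mul_right_comm, ← map_mul, mul_inv_cancel, map_one, one_mul] at h2
  have h3 : modularCharacter p * modularCharacter p = 1 := by
    nth_rewrite 2 [h2]
    rw [← map_mul, mul_inv_cancel, map_one]
  have h4 : (modularCharacter p) ^ 2 = 1 := by rw [sq, h3]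
  exact (pow_eq_one_iff_of_nonneg zero_le two_ne_zero).1 h4

-- Polar decomposition: dividing out the phase of `a` on the right writes `g` as an element with
-- real `a` times a diagonal one.
open Measure in
theorem modularCharacterFun_eq_one (g : SU11) : modularCharacterFun g = 1 := by
  have ha : (‖g.a‖ : ℂ) ≠ 0 := by exact_mod_cast (norm_pos_iff.2 g.a_ne_zero).ne'
  have hu : g.a / ‖g.a‖ * conj (g.a / ‖g.a‖) = 1 := by
    rw [map_div₀, Complex.conj_ofReal, div_mul_div_comm, Complex.mul_conj', sq]
    field_simp
  let k : SU11 := ofRow (g.a / ‖g.a‖) 0 (by simpa using hu)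
  have hp : conj (g * k⁻¹).a = (g * k⁻¹).a := by
    have : (g * k⁻¹).a = ‖g.a‖ := by
      simp only [k, mul_a, inv_a, inv_b, ofRow_a, ofRow_b, map_div₀, Complex.conj_ofReal, neg_zero,
        map_zero, mul_zero, add_zero]
      rw [mul_div_assoc', Complex.mul_conj', sq]
      field_simp
    rw [this, Complex.conj_ofReal]
  have h : g = g * k⁻¹ * k := by group
  rw [h, modularCharacterFun_map_mul, modularCharacterFun_eq_one_of_conj_a hp,
    modularCharacterFun_eq_one_of_b_eq_zero (by simp [k]), one_mul]

theorem map_mul_right_eq_self [MeasurableSpace SU11] [BorelSpace SU11] (μ : Measure SU11)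
    [μ.IsHaarMeasure] (g : SU11) : μ.map (· * g) = μ := by
  rw [Measure.map_right_mul_eq_modularCharacterFun_smul, modularCharacterFun_eq_one, one_smul]

end SU11

/-! ### Lifting an invariant measure from the quotient by a discrete subgroup -/

section Unfolding

variable {Γ : Type*} [Group Γ] [TopologicalSpace Γ] [IsTopologicalGroup Γ]
  [MeasurableSpace Γ] [BorelSpace Γ] {S : Subgroup Γ}

/-- Small open sets embed openly into the quotient because `S` is discrete. Countably many
translates cover `Γ`, and the local inverses are glued along the disjointed images. -/
theorem exists_measurable_section [SecondCountableTopology Γ] {W : Set Γ} (hW : W ∈ 𝓝 (1 : Γ))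
    (hWS : ∀ g ∈ W, g ∈ S → g = 1) :
    ∃ σ : Γ ⧸ S → Γ, @Measurable _ _ (borel (Γ ⧸ S)) _ σ ∧
      ∀ x, (QuotientGroup.mk (σ x) : Γ ⧸ S) = x := by
  let _ : MeasurableSpace (Γ ⧸ S) := borel (Γ ⧸ S)
  have : BorelSpace (Γ ⧸ S) := ⟨rfl⟩
  obtain ⟨V', hV', hVW'⟩ := exists_nhds_one_inv_mul hW
  obtain ⟨V, hVV', hVo, hV1⟩ := mem_nhds_iff.1 hV'
  have hVW : ∀ v ∈ V, ∀ w ∈ V, v⁻¹ * w ∈ W := fun v hv w hw => hVW' v (hVV' hv) w (hVV' hw)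
  let d : ℕ → Γ := TopologicalSpace.denseSeq Γ
  let U : ℕ → Set Γ := fun n => (fun x => (d n)⁻¹ * x) ⁻¹' V
  have hUo : ∀ n, IsOpen (U n) := fun n => hVo.preimage (continuous_const_mul _)
  have hcover : ∀ g, ∃ n, g ∈ U n := by
    intro g
    have ho : IsOpen ((fun x => x⁻¹ * g) ⁻¹' V) := hVo.preimage (by fun_prop)
    obtain ⟨_, hx, n, rfl⟩ := (TopologicalSpace.denseRange_denseSeq Γ).inter_open_nonempty _ ho
      ⟨g, by simpa using hV1⟩
    exact ⟨n, hx⟩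
  have hemb : ∀ n, IsOpenEmbedding fun x : U n => (QuotientGroup.mk (x : Γ) : Γ ⧸ S) := by
    intro n
    refine IsOpenEmbedding.of_continuous_injective_isOpenMap
      (QuotientGroup.continuous_mk.comp continuous_subtype_val) ?_
      (QuotientGroup.isOpenMap_coe.comp (hUo n).isOpenMap_subtype_val)
    rintro ⟨x, hx⟩ ⟨y, hy⟩ hxy
    have h1 := QuotientGroup.eq.1 hxy
    have h2 := hVW _ hx _ hy
    have h3 : ((d n)⁻¹ * x)⁻¹ * ((d n)⁻¹ * y) = x⁻¹ * y := by group
    rw [h3] at h2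
    exact Subtype.ext (inv_mul_eq_one.1 (hWS _ h2 h1))
  -- The values of the extension off the image of `U n` do not matter: it is used only on `T n`.
  choose s hs hs' using fun n => (hemb n).measurableEmbedding.exists_measurable_extend
    (g := fun x : U n => (x : Γ)) measurable_subtype_coe (fun _ => ⟨1⟩)
  let T : ℕ → Set (Γ ⧸ S) := disjointed fun n => (QuotientGroup.mk : Γ → Γ ⧸ S) '' U n
  have hT : ∀ n, MeasurableSet (T n) :=
    MeasurableSet.disjointed fun n => (QuotientGroup.isOpenMap_coe _ (hUo n)).measurableSet
  obtain ⟨σ, hσ, hσT⟩ := exists_measurable_piecewise T hT s hs (fun i j hij => by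
    have h : T i ∩ T j = ∅ := Set.disjoint_iff_inter_eq_empty.1
      (disjoint_disjointed (fun n => (QuotientGroup.mk : Γ → Γ ⧸ S) '' U n) hij)
    change Set.EqOn (s i) (s j) (T i ∩ T j)
    rw [h]
    exact Set.eqOn_empty _ _)
  refine ⟨σ, hσ, fun x => ?_⟩
  have hx : x ∈ ⋃ n, T n := by
    rw [iUnion_disjointed]
    obtain ⟨g, rfl⟩ := QuotientGroup.mk_surjective x
    obtain ⟨n, hn⟩ := hcover g
    exact Set.mem_iUnion.2 ⟨n, g, hn, rfl⟩
  obtain ⟨n, hn⟩ := Set.mem_iUnion.1 hx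
  rw [hσT n hn]
  obtain ⟨y, hy, rfl⟩ := disjointed_subset _ _ hn
  have := congrFun (hs' n) ⟨y, hy⟩
  simp only [Function.comp_apply] at this
  rw [this]

/-- The measure on `Γ` obtained from a measure on `Γ ⧸ S` and the counting measure on the fibres,
by means of a section `σ`. -/
def unfoldMeasure (μ : @Measure (Γ ⧸ S) (borel (Γ ⧸ S))) (σ : Γ ⧸ S → Γ) : Measure Γ :=
  letI : MeasurableSpace (Γ ⧸ S) := borel (Γ ⧸ S)
  Measure.sum fun s : S => μ.map fun x => σ x * s

variable {μ : @Measure (Γ ⧸ S) (borel (Γ ⧸ S))} {σ : Γ ⧸ S → Γ}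

theorem unfoldMeasure_apply [Countable S] (hσ : @Measurable _ _ (borel (Γ ⧸ S)) _ σ) {E : Set Γ}
    (hE : MeasurableSet E) : unfoldMeasure μ σ E
      = @lintegral _ (borel (Γ ⧸ S)) μ fun x => ∑' s : S, E.indicator 1 (σ x * s) := by
  let _ : MeasurableSpace (Γ ⧸ S) := borel (Γ ⧸ S)
  have hm : ∀ s : S, Measurable fun x => σ x * s := fun s => hσ.mul_const _
  have h1 : ∀ s : S, Measurable fun x => E.indicator (1 : Γ → ENNReal) (σ x * s) := fun s =>
    (measurable_one.indicator hE).comp (hm s)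
  rw [lintegral_tsum fun s => (h1 s).aemeasurable]
  refine (Measure.sum_apply _ hE).trans (tsum_congr fun s => ?_)
  rw [Measure.map_apply (hm s) hE, ← lintegral_indicator_one (hm s hE)]
  rfl

/-- Counting points per coset bounds the volume. It is used with `k = 1` for local finiteness and
with `k = 2` for the transversal in `SU(1,1)`. -/
theorem unfoldMeasure_le [Countable S] (hσ : @Measurable _ _ (borel (Γ ⧸ S)) _ σ) {E : Set Γ}
    (hE : MeasurableSet E) {k : ℕ} (hk : ∀ g : Γ, ∃ F : Finset S, F.card ≤ k ∧
      ∀ s : S, g * s ∈ E → s ∈ F) : unfoldMeasure μ σ E ≤ k * μ Set.univ := by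
  let _ : MeasurableSpace (Γ ⧸ S) := borel (Γ ⧸ S)
  rw [unfoldMeasure_apply hσ hE, ← lintegral_const]
  refine lintegral_mono fun x => ?_
  obtain ⟨F, hF, hF'⟩ := hk (σ x)
  rw [tsum_eq_sum (s := F) fun s hs => Set.indicator_of_notMem (fun h => hs (hF' s h)) _]
  refine (Finset.sum_le_card_nsmul F _ 1 fun s _ => ?_).trans ?_
  · exact Set.indicator_le_self' (fun _ _ => zero_le) _
  · rw [nsmul_one]
    exact_mod_cast hF

/-- The representatives `σ (g • x)` and `g * σ x` differ by an element of `S`, which only permutes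
the sum over the fibre; invariance of `μ` does the rest. -/
theorem isMulLeftInvariant_unfoldMeasure [Countable S]
    (hσ : @Measurable _ _ (borel (Γ ⧸ S)) _ σ)
    (hσ' : ∀ x, (QuotientGroup.mk (σ x) : Γ ⧸ S) = x) (hμ : IsInvariantOn S μ) :
    (unfoldMeasure μ σ).IsMulLeftInvariant := by
  let _ : MeasurableSpace (Γ ⧸ S) := borel (Γ ⧸ S)
  have : BorelSpace (Γ ⧸ S) := ⟨rfl⟩
  have : SMulInvariantMeasure Γ (Γ ⧸ S) μ := hμ
  refine ⟨fun g => Measure.ext fun E hE => ?_⟩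
  rw [Measure.map_apply (measurable_const_mul g) hE, unfoldMeasure_apply hσ hE,
    unfoldMeasure_apply hσ (measurable_const_mul g hE)]
  have key : ∀ x : Γ ⧸ S, ∑' s : S, ((fun y => g * y) ⁻¹' E).indicator (1 : Γ → ENNReal) (σ x * s)
      = ∑' s : S, E.indicator 1 (σ (g • x) * s) := by
    intro x
    have h1 : (σ (g • x))⁻¹ * (g * σ x) ∈ S := by
      rw [← QuotientGroup.eq, hσ']
      change g • x = g • (QuotientGroup.mk (σ x) : Γ ⧸ S)
      rw [hσ']
    rw [← (Equiv.mulLeft (⟨_, h1⟩ : S)).tsum_eq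
      (fun s : S => E.indicator (1 : Γ → ENNReal) (σ (g • x) * s))]
    refine tsum_congr fun s => ?_
    have h2 : σ (g • x) * ((Equiv.mulLeft (⟨_, h1⟩ : S) s : S) : Γ) = g * (σ x * s) := by
      simp only [Equiv.coe_mulLeft, Subgroup.coe_mul]
      group
    rw [h2]
    rfl
  simp only [key]
  have hm : Measurable fun x : Γ ⧸ S => ∑' s : S, E.indicator (1 : Γ → ENNReal) (σ x * s) :=
    Measurable.tsum fun s => (measurable_one.indicator hE).comp (hσ.mul_const _)
  exact (measurePreserving_smul g μ).lintegral_comp hm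

/-- Beyond invariance, local finiteness is needed: a small enough open set meets each coset at most
once, so its volume is at most the total mass of `μ`. -/
theorem isHaarMeasure_unfoldMeasure [SecondCountableTopology Γ] [LocallyCompactSpace Γ] [T2Space Γ]
    [Countable S] {W : Set Γ} (hW : W ∈ 𝓝 (1 : Γ)) (hWS : ∀ g ∈ W, g ∈ S → g = 1)
    (hσ : @Measurable _ _ (borel (Γ ⧸ S)) _ σ)
    (hσ' : ∀ x, (QuotientGroup.mk (σ x) : Γ ⧸ S) = x) (hμ : IsInvariantOn S μ)
    (h0 : μ Set.univ ≠ 0) (htop : μ Set.univ ≠ ⊤) : (unfoldMeasure μ σ).IsHaarMeasure := by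
  have := isMulLeftInvariant_unfoldMeasure hσ hσ' hμ
  have hloc : IsLocallyFiniteMeasure (unfoldMeasure μ σ) := by
    refine ⟨fun g => ?_⟩
    obtain ⟨V', hV', hVW'⟩ := exists_nhds_one_inv_mul hW
    obtain ⟨V, hVV', hVo, hV1⟩ := mem_nhds_iff.1 hV'
    have ho : IsOpen ((fun x => g⁻¹ * x) ⁻¹' V) := hVo.preimage (continuous_const_mul _)
    refine ⟨_, ho.mem_nhds (by simpa using hV1), ?_⟩
    refine (unfoldMeasure_le hσ ho.measurableSet (k := 1) fun x => ?_).trans_lt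
      (ENNReal.mul_lt_top (by simp) htop.lt_top)
    by_cases hx : ∃ s : S, x * s ∈ (fun x => g⁻¹ * x) ⁻¹' V
    · obtain ⟨s, hs⟩ := hx
      refine ⟨{s}, by simp, fun t ht => ?_⟩
      have h1 := hVW' _ (hVV' hs) _ (hVV' ht)
      have h2 : (g⁻¹ * (x * (s : Γ)))⁻¹ * (g⁻¹ * (x * t)) = ((s⁻¹ * t : S) : Γ) := by
        push_cast; group
      rw [h2] at h1
      have h3 : s⁻¹ * t = 1 := Subtype.ext (hWS _ h1 (s⁻¹ * t).2)
      rw [Finset.mem_singleton, ← inv_mul_eq_one.1 h3]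
    · exact ⟨∅, by simp, fun s hs => (hx ⟨s, hs⟩).elim⟩
  have hne : NeZero (unfoldMeasure μ σ) := by
    refine ⟨fun h => h0 ?_⟩
    let _ : MeasurableSpace (Γ ⧸ S) := borel (Γ ⧸ S)
    have h1 : unfoldMeasure μ σ Set.univ = 0 := by rw [h]; rfl
    have h2 : μ.map (fun x => σ x * ((1 : S) : Γ)) Set.univ ≤ unfoldMeasure μ σ Set.univ :=
      Measure.le_sum (fun s : S => μ.map fun x => σ x * s) 1 _
    rw [h1, Measure.map_apply (hσ.mul_const _) MeasurableSet.univ] at h2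
    exact le_antisymm h2 zero_le
  have : IsFiniteMeasureOnCompacts (unfoldMeasure μ σ) := inferInstance
  exact { }

end Unfolding


/-! ### The hyperbolic area -/

instance : MeasurableSpace 𝔻 := borel 𝔻

instance : BorelSpace 𝔻 := ⟨rfl⟩

instance : SecondCountableTopology 𝔻 :=
  Complex.UnitDisc.isEmbedding_coe.secondCountableTopology

instance : T2Space 𝔻 := Complex.UnitDisc.isEmbedding_coe.t2Space

theorem isOpenEmbedding_coe : IsOpenEmbedding ((↑) : 𝔻 → ℂ) where
  toIsEmbedding := Complex.UnitDisc.isEmbedding_coe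
  isOpen_range := by
    have h : Set.range ((↑) : 𝔻 → ℂ) = Metric.ball 0 1 := by
      ext z
      exact ⟨fun ⟨w, hw⟩ => hw ▸ UnitDisc.coe_mem_ball w, UnitDisc.exists_coe_eq⟩
    rw [h]
    exact Metric.isOpen_ball

/-- The density of the hyperbolic area. -/
def areaDensity (z : ℂ) : ENNReal := ENNReal.ofReal (1 / (1 - ‖z‖ ^ 2) ^ 2)

/-- The hyperbolic area on the disc. -/
def hyperbolicArea : Measure 𝔻 := (volume.withDensity areaDensity).comap ((↑) : 𝔻 → ℂ)

theorem hyperbolicArea_apply {E : Set 𝔻} (hE : MeasurableSet E) :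
    hyperbolicArea E = ∫⁻ z in ((↑) : 𝔻 → ℂ) '' E, areaDensity z := by
  have hm := isOpenEmbedding_coe.measurableEmbedding
  rw [hyperbolicArea, hm.comap_apply, withDensity_apply _ (hm.measurableSet_image' hE)]

theorem SU11.areaDensity_smul (g : SU11) (z : 𝔻) :
    ENNReal.ofReal (‖1 / (conj g.b * (z : ℂ) + conj g.a) ^ 2‖ ^ 2) * areaDensity (g • z : 𝔻)
      = areaDensity z := by
  have h0 := norm_ne_zero_iff.2 (g.den_ne_zero z)
  have h1 := (g⁻¹).one_sub_norm_sq_inv_smul z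
  simp only [inv_inv, inv_a, inv_b, map_neg, sub_neg_eq_add, neg_mul] at h1
  have hz : 1 - ‖(z : ℂ)‖ ^ 2 ≠ 0 := by
    have := z.sq_norm_lt_one
    linarith
  rw [areaDensity, areaDensity, ← ENNReal.ofReal_mul (by positivity), h1, add_comm (conj g.a),
    norm_div, norm_pow, norm_one]
  congr 1
  field_simp

instance : SMulInvariantMeasure SU11 𝔻 hyperbolicArea := by
  refine ⟨fun g E hE => ?_⟩
  have hE' : MeasurableSet ((fun z : 𝔻 => g • z) ⁻¹' E) := g.continuous_smul.measurable hE
  rw [hyperbolicArea_apply hE, hyperbolicArea_apply hE']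
  have hm := isOpenEmbedding_coe.measurableEmbedding
  let φ : ℂ → ℂ := fun w => (g.a * w + g.b) / (conj g.b * w + conj g.a)
  let φ' : ℂ → ℂ →L[ℝ] ℂ := fun z =>
    (ContinuousLinearMap.toSpanSingleton ℂ (1 / (conj g.b * z + conj g.a) ^ 2)).restrictScalars ℝ
  have himg : ((↑) : 𝔻 → ℂ) '' E = φ '' (((↑) : 𝔻 → ℂ) '' ((fun z : 𝔻 => g • z) ⁻¹' E)) := by
    ext w
    constructor
    · rintro ⟨x, hx, rfl⟩
      refine ⟨_, ⟨g⁻¹ • x, by simpa using hx, rfl⟩, ?_⟩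
      change ((g • g⁻¹ • x : 𝔻) : ℂ) = x
      rw [smul_inv_smul]
    · rintro ⟨_, ⟨x, hx, rfl⟩, rfl⟩
      exact ⟨g • x, hx, rfl⟩
  have hinj : Set.InjOn φ (((↑) : 𝔻 → ℂ) '' ((fun z : 𝔻 => g • z) ⁻¹' E)) := by
    rintro _ ⟨x, -, rfl⟩ _ ⟨y, -, rfl⟩ hxy
    have h : g • x = g • y := Complex.UnitDisc.coe_injective hxy
    rw [smul_left_cancel g h]
  rw [himg, lintegral_image_eq_lintegral_abs_det_fderiv_mul volume (hm.measurableSet_image' hE')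
    (f' := φ') ?_ hinj]
  · refine setLIntegral_congr_fun (hm.measurableSet_image' hE') ?_
    rintro _ ⟨z, -, rfl⟩
    -- The real Jacobian of multiplication by a complex number `c` is its algebra norm `|c|²`.
    have hdet : (φ' z).det = ‖1 / (conj g.b * (z : ℂ) + conj g.a) ^ 2‖ ^ 2 := by
      generalize hc : 1 / (conj g.b * (z : ℂ) + conj g.a) ^ 2 = c
      have h1 : ((φ' z : ℂ →L[ℝ] ℂ) : ℂ →ₗ[ℝ] ℂ) = Algebra.lmul ℝ ℂ c := by
        ext w
        rw [← hc]
        simp [φ', mul_comm]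
      rw [ContinuousLinearMap.det, h1, ← Complex.normSq_eq_norm_sq, ← Algebra.norm_complex_apply]
      rfl
    change areaDensity z = ENNReal.ofReal |(φ' z).det| * areaDensity (φ z)
    rw [hdet, abs_of_nonneg (by positivity)]
    exact (g.areaDensity_smul z).symm
  · rintro _ ⟨z, -, rfl⟩
    exact ((g.hasDerivAt_smul z).hasFDerivAt.restrictScalars ℝ).hasFDerivWithinAt

theorem SU11.exists_smul_zero_eq (z : 𝔻) : ∃ g : SU11, g • (0 : 𝔻) = z := by
  have hz : 0 < 1 - ‖(z : ℂ)‖ ^ 2 := by have := z.sq_norm_lt_one; linarith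
  set r : ℝ := Real.sqrt (1 - ‖(z : ℂ)‖ ^ 2) with hr
  have hr0 : (r : ℂ) ≠ 0 := by exact_mod_cast (Real.sqrt_pos.2 hz).ne'
  have hr2 : (r : ℂ) ^ 2 = 1 - (z : ℂ) * conj (z : ℂ) := by
    rw [Complex.mul_conj']
    exact_mod_cast Real.sq_sqrt hz.le
  refine ⟨ofRow (1 / r) (z / r) ?_, ?_⟩
  · simp only [map_div₀, map_one, Complex.conj_ofReal]
    field_simp
    rw [hr2]
  · apply Complex.UnitDisc.coe_injective
    rw [coe_smul]
    simp only [ofRow_a, ofRow_b, Complex.UnitDisc.coe_zero, mul_zero, zero_add, map_div₀, map_one,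
      Complex.conj_ofReal]
    field_simp

instance : SigmaFinite hyperbolicArea := by
  have hm := isOpenEmbedding_coe.measurableEmbedding
  have h : SigmaFinite (volume.withDensity areaDensity) :=
    SigmaFinite.withDensity_ofReal _
  refine SigmaFinite.of_map _ hm.measurable.aemeasurable ?_
  rw [hyperbolicArea, hm.map_comap]
  infer_instance

theorem hyperbolicArea_ball_lt_top :
    hyperbolicArea {z : 𝔻 | ‖(z : ℂ)‖ < 1 / 2} < ⊤ := by
  have ho : IsOpen {z : 𝔻 | ‖(z : ℂ)‖ < 1 / 2} :=
    isOpen_lt Complex.UnitDisc.continuous_coe.norm continuous_const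
  rw [hyperbolicArea_apply ho.measurableSet]
  have hsub : ((↑) : 𝔻 → ℂ) '' {z : 𝔻 | ‖(z : ℂ)‖ < 1 / 2} ⊆ Metric.ball 0 (1 / 2) := by
    rintro _ ⟨z, hz, rfl⟩
    exact mem_ball_zero_iff.2 hz
  refine (setLIntegral_mono measurable_const (g := fun _ => ENNReal.ofReal (16 / 9)) ?_).trans_lt ?_
  · rintro _ ⟨z, hz, rfl⟩
    refine ENNReal.ofReal_le_ofReal ?_
    have h1 : ‖(z : ℂ)‖ < 1 / 2 := hz
    have h2 : (3 / 4 : ℝ) ≤ 1 - ‖(z : ℂ)‖ ^ 2 := by nlinarith [norm_nonneg (z : ℂ)]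
    rw [div_le_div_iff₀ (by positivity) (by norm_num)]
    nlinarith
  · rw [setLIntegral_const]
    exact ENNReal.mul_lt_top ENNReal.ofReal_lt_top
      ((measure_mono hsub).trans_lt measure_ball_lt_top)

/-- Comparison of a Haar measure on `SU(1,1)` with the hyperbolic area. -/
theorem hyperbolicArea_mul_haar [MeasurableSpace SU11] [BorelSpace SU11] (μ : Measure SU11)
    [μ.IsHaarMeasure] {E B : Set 𝔻} (hE : MeasurableSet E) (hB : MeasurableSet B) :
    hyperbolicArea E * μ {g | g • (0 : 𝔻) ∈ B} = hyperbolicArea B * μ {g | g⁻¹ • (0 : 𝔻) ∈ E} := by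
  have hact : Measurable fun p : SU11 × 𝔻 => p.1 • p.2 := SU11.continuous_smul_prod.measurable
  have hact' : Measurable fun p : SU11 × 𝔻 => p.1⁻¹ • p.2 := by
    have h : Continuous fun p : SU11 × 𝔻 => p.1⁻¹ • p.2 := continuous_fst.inv.smul continuous_snd
    exact h.measurable
  have hx : ∀ x : 𝔻, Measurable fun g : SU11 => g • x := fun x =>
    (continuous_id.smul continuous_const).measurable
  have hx' : ∀ x : 𝔻, Measurable fun g : SU11 => g⁻¹ • x := fun x =>
    (continuous_inv.smul continuous_const).measurable
  -- Transitivity writes `x = h • 0`; moving `h` to the other side is a right translation, and this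
  -- is where unimodularity enters. The analogue `h2` for inverses needs only left invariance.
  have h1 : ∀ x : 𝔻, μ {g | g • x ∈ B} = μ {g | g • (0 : 𝔻) ∈ B} := by
    intro x
    obtain ⟨h, rfl⟩ := SU11.exists_smul_zero_eq x
    have hm : MeasurableSet {g : SU11 | g • (0 : 𝔻) ∈ B} := hx 0 hB
    conv_rhs => rw [← SU11.map_mul_right_eq_self μ h, Measure.map_apply (measurable_mul_const h) hm]
    simp only [Set.preimage_ofPred_eq, mul_smul]
  have h2 : ∀ x : 𝔻, μ {g | g⁻¹ • x ∈ E} = μ {g | g⁻¹ • (0 : 𝔻) ∈ E} := by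
    intro x
    obtain ⟨h, rfl⟩ := SU11.exists_smul_zero_eq x
    rw [← measure_preimage_mul μ h⁻¹ {g | g⁻¹ • (0 : 𝔻) ∈ E}]
    simp only [Set.preimage_ofPred_eq, mul_inv_rev, inv_inv, mul_smul]
  -- One double integral is evaluated in two ways, the second after the substitution `y = g • x`,
  -- which preserves the area.
  have i1 : ∫⁻ g, ∫⁻ x, E.indicator 1 x * B.indicator 1 (g • x) ∂hyperbolicArea ∂μ
      = hyperbolicArea E * μ {g | g • (0 : 𝔻) ∈ B} := by
    rw [lintegral_lintegral_swap]
    · have h3 : ∀ x : 𝔻, ∫⁻ g, E.indicator (1 : 𝔻 → ENNReal) x * B.indicator 1 (g • x) ∂μ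
          = E.indicator 1 x * μ {g | g • (0 : 𝔻) ∈ B} := by
        intro x
        rw [lintegral_const_mul (f := fun g : SU11 => B.indicator (1 : 𝔻 → ENNReal) (g • x)) _
          ((measurable_one.indicator hB).comp (hx x)), ← h1 x]
        exact congrArg _ (lintegral_indicator_one (hx x hB))
      simp only [h3]
      rw [lintegral_mul_const _ (measurable_one.indicator hE), lintegral_indicator_one hE]
    · exact (((measurable_one.indicator hE).comp measurable_snd).mul
        ((measurable_one.indicator hB).comp hact)).aemeasurable
  have i2 : ∫⁻ g, ∫⁻ x, E.indicator 1 x * B.indicator 1 (g • x) ∂hyperbolicArea ∂μ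
      = hyperbolicArea B * μ {g | g⁻¹ • (0 : 𝔻) ∈ E} := by
    have h4 : ∀ g : SU11, ∫⁻ x, E.indicator (1 : 𝔻 → ENNReal) x * B.indicator 1 (g • x)
        ∂hyperbolicArea = ∫⁻ y, E.indicator 1 (g⁻¹ • y) * B.indicator 1 y ∂hyperbolicArea := by
      intro g
      have hm : Measurable fun y : 𝔻 =>
          E.indicator (1 : 𝔻 → ENNReal) (g⁻¹ • y) * B.indicator 1 y :=
        ((measurable_one.indicator hE).comp g⁻¹.continuous_smul.measurable).mul
          (measurable_one.indicator hB)
      rw [← (measurePreserving_smul g hyperbolicArea).lintegral_comp hm]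
      simp only [inv_smul_smul]
    simp only [h4]
    rw [lintegral_lintegral_swap]
    · have h3 : ∀ y : 𝔻, ∫⁻ g, E.indicator (1 : 𝔻 → ENNReal) (g⁻¹ • y) * B.indicator 1 y ∂μ
          = B.indicator 1 y * μ {g | g⁻¹ • (0 : 𝔻) ∈ E} := by
        intro y
        rw [lintegral_mul_const (f := fun g : SU11 => E.indicator (1 : 𝔻 → ENNReal) (g⁻¹ • y)) _
          ((measurable_one.indicator hE).comp (hx' y)), ← h2 y, mul_comm]
        exact congrArg _ (lintegral_indicator_one (hx' y hE))
      simp only [h3]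
      rw [lintegral_mul_const _ (measurable_one.indicator hB), lintegral_indicator_one hB]
    · exact (((measurable_one.indicator hE).comp hact').mul
        ((measurable_one.indicator hB).comp measurable_snd)).aemeasurable
  rw [← i1, i2]

/-- In the comparison with Haar measure take for `B` the disc of radius 1/2: its area is finite, and
the group elements sending 0 into it have positive measure. -/
theorem hyperbolicArea_lt_top [MeasurableSpace SU11] [BorelSpace SU11] (μ : Measure SU11)
    [μ.IsHaarMeasure] {E : Set 𝔻} (hE : MeasurableSet E)
    (h : μ {g | g⁻¹ • (0 : 𝔻) ∈ E} < ⊤) : hyperbolicArea E < ⊤ := by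
  have ho : IsOpen {z : 𝔻 | ‖(z : ℂ)‖ < 1 / 2} :=
    isOpen_lt Complex.UnitDisc.continuous_coe.norm continuous_const
  have hc : Continuous fun g : SU11 => g • (0 : 𝔻) :=
    continuous_id.smul continuous_const
  have hpos : μ {g | g • (0 : 𝔻) ∈ {z : 𝔻 | ‖(z : ℂ)‖ < 1 / 2}} ≠ 0 :=
    ((ho.preimage hc).measure_pos μ ⟨1, by simp⟩).ne'
  have h1 := hyperbolicArea_mul_haar μ hE ho.measurableSet
  have h2 : hyperbolicArea E * μ {g | g • (0 : 𝔻) ∈ {z : 𝔻 | ‖(z : ℂ)‖ < 1 / 2}} < ⊤ := by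
    rw [h1]
    exact ENNReal.mul_lt_top hyperbolicArea_ball_lt_top h
  exact ENNReal.lt_top_of_mul_ne_top_left h2.ne hpos


/-! ### Discrete groups of automorphisms of the disc -/

section Discrete

variable {S : Subgroup SU11}

/-- Properness of the action in quantitative form: `(1 - |g z|²) |conj b z + conj a|² = 1 - |z|²`
bounds the denominator from above, and the denominator is at least `(1 - r) |a|`. -/
theorem SU11.norm_a_le {r : ℝ} (hr : r < 1) {g : SU11} {z : 𝔻} (hz : ‖(z : ℂ)‖ ≤ r)
    (hgz : ‖((g • z : 𝔻) : ℂ)‖ ≤ r) : ‖g.a‖ ≤ 1 / ((1 - r) * (1 - r)) := by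
  have h1 := (g⁻¹).one_sub_norm_sq_inv_smul z
  have hd := norm_pos_iff.2 (g.den_ne_zero z)
  simp only [inv_inv, inv_a, inv_b, map_neg, sub_neg_eq_add, neg_mul] at h1
  rw [add_comm (conj g.a)] at h1
  set D := ‖conj g.b * (z : ℂ) + conj g.a‖ with hD
  have hr0 : 0 ≤ r := (norm_nonneg _).trans hz
  have h2 : (1 - ‖((g • z : 𝔻) : ℂ)‖ ^ 2) * D ^ 2 ≤ 1 := by
    rw [h1, div_mul_cancel₀ _ (pow_pos hd 2).ne']
    nlinarith [sq_nonneg ‖(z : ℂ)‖]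
  have h3 : (1 - r) * D ≤ 1 := by
    have h4 : 1 - r ≤ 1 - ‖((g • z : 𝔻) : ℂ)‖ ^ 2 := by
      nlinarith [norm_nonneg ((g • z : 𝔻) : ℂ)]
    have h5 : ((1 - r) * D) ^ 2 ≤ 1 := by
      have h6 : (1 - r) * D ^ 2 ≤ 1 := (mul_le_mul_of_nonneg_right h4 (sq_nonneg D)).trans h2
      have h7 : (1 - r) ^ 2 * D ^ 2 ≤ (1 - r) * D ^ 2 :=
        mul_le_mul_of_nonneg_right (by nlinarith) (sq_nonneg D)
      nlinarith
    nlinarith [mul_pos (sub_pos.2 hr) hd]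
  have h8 : ‖g.a‖ * (1 - r) ≤ D := by
    have h9 : ‖conj g.a‖ ≤ D + ‖conj g.b * (z : ℂ)‖ := by
      have := norm_sub_le (conj g.b * (z : ℂ) + conj g.a) (conj g.b * (z : ℂ))
      rwa [add_sub_cancel_left] at this
    rw [norm_mul, Complex.norm_conj, Complex.norm_conj] at h9
    nlinarith [g.norm_b_lt, norm_nonneg g.b, norm_nonneg (z : ℂ), norm_nonneg g.a]
  rw [le_div_iff₀ (mul_pos (sub_pos.2 hr) (sub_pos.2 hr))]
  nlinarith [sub_pos.2 hr]

theorem finite_inter_of_isCompact {W : Set SU11} (hW : W ∈ 𝓝 (1 : SU11))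
    (hWS : ∀ g ∈ W, g ∈ S → g = 1) {K : Set SU11} (hK : IsCompact K) :
    {s : SU11 | s ∈ S ∧ s ∈ K}.Finite := by
  have hd : DiscreteTopology S := discreteTopology_of_nhds hW hWS
  have h1 := (Subgroup.tendsto_coe_cofinite_of_discrete S ⟨hd⟩) hK.compl_mem_cocompact
  rw [Filter.mem_map, Filter.mem_cofinite] at h1
  refine (h1.image Subtype.val).subset ?_
  rintro s ⟨hs, hsK⟩
  exact ⟨⟨s, hs⟩, by simpa using hsK, rfl⟩

/-- A set which meets its translates under `S` only for the trivial elements `±1`. -/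
def IsWandering (S : Subgroup SU11) (B : Set 𝔻) : Prop :=
  ∀ s ∈ S, ∀ z ∈ B, s • z ∈ B → s = 1 ∨ s = SU11.negOne

/-- By properness and discreteness only finitely many elements of `S` return a point of a fixed
smaller disc to it. Each one that moves `x` is excluded by separating `x` from its image. -/
theorem exists_isWandering_nhds {W : Set SU11} (hW : W ∈ 𝓝 (1 : SU11))
    (hWS : ∀ g ∈ W, g ∈ S → g = 1) {x : 𝔻}
    (hx : ∀ s ∈ S, s • x = x → s = 1 ∨ s = SU11.negOne) : ∃ U ∈ 𝓝 x, IsWandering S U := by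
  obtain ⟨r, hxr, hr⟩ := exists_between x.norm_lt_one
  have hF := finite_inter_of_isCompact hW hWS (SU11.isCompact_norm_b_le (1 / ((1 - r) * (1 - r))))
  set F := {s : SU11 | s ∈ S ∧ s ∈ {g : SU11 | ‖g.b‖ ≤ 1 / ((1 - r) * (1 - r))}} with hFdef
  have hU0 : {z : 𝔻 | ‖(z : ℂ)‖ < r} ∈ 𝓝 x :=
    (isOpen_lt Complex.UnitDisc.continuous_coe.norm continuous_const).mem_nhds hxr
  have hUs : ∀ s ∈ F, ∃ U ∈ 𝓝 x, (s = 1 ∨ s = SU11.negOne) ∨ ∀ z ∈ U, s • z ∉ U := by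
    intro s hs
    by_cases h : s • x = x
    · exact ⟨Set.univ, Filter.univ_mem, Or.inl (hx s hs.1 h)⟩
    · obtain ⟨A, B, hA, hB, hxA, hxB, hAB⟩ := t2_separation h
      refine ⟨(fun z => s • z) ⁻¹' A ∩ B, Filter.inter_mem
        (s.continuous_smul.continuousAt.preimage_mem_nhds (hA.mem_nhds hxA)) (hB.mem_nhds hxB),
        Or.inr fun z hz hz' => ?_⟩
      exact Set.disjoint_left.1 hAB hz.1 hz'.2
  choose! U hU hU' using hUs
  refine ⟨{z : 𝔻 | ‖(z : ℂ)‖ < r} ∩ ⋂ s ∈ F, U s,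
    Filter.inter_mem hU0 ((Filter.biInter_mem hF).2 hU), ?_⟩
  rintro s hs z ⟨hzr, hzU⟩ ⟨hszr, hszU⟩
  have hsF : s ∈ F :=
    ⟨hs, s.norm_b_lt.le.trans (SU11.norm_a_le hr (le_of_lt hzr) (le_of_lt hszr))⟩
  rcases hU' s hsF with h | h
  · exact h
  · exact (h z (Set.mem_iInter₂.1 hzU s hsF) (Set.mem_iInter₂.1 hszU s hsF)).elim

/-- Fixed points are roots of `conj b z² + (conj a - a) z - b`, a polynomial that vanishes
identically only for the matrices `±1`. -/
theorem SU11.finite_fixedPoints {s : SU11} (h1 : s ≠ 1) (h2 : s ≠ negOne) :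
    {z : 𝔻 | s • z = z}.Finite := by
  let p : Polynomial ℂ := Polynomial.C (conj s.b) * Polynomial.X ^ 2
    + Polynomial.C (conj s.a - s.a) * Polynomial.X + Polynomial.C (-s.b)
  have hp : p ≠ 0 := by
    intro hp
    have hb : s.b = 0 := by
      have := congrArg (Polynomial.eval 0) hp
      simpa [p] using this
    have ha : conj s.a = s.a := by
      have := congrArg (Polynomial.eval 1) hp
      simp [p, hb] at this
      linear_combination this
    have h3 := s.det_eq
    rw [ha, hb, zero_mul, sub_zero, mul_self_eq_one_iff] at h3
    rcases h3 with h3 | h3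
    · exact h1 (ext' (by simpa using h3) (by simpa using hb))
    · exact h2 (ext' (by simpa using h3) (by simpa using hb))
  refine Set.Finite.of_finite_image ((Polynomial.finite_setOfPred_isRoot hp).subset ?_)
    Complex.UnitDisc.coe_injective.injOn
  rintro _ ⟨z, hz, rfl⟩
  have h3 : ((s • z : 𝔻) : ℂ) = z := congrArg _ hz
  rw [coe_smul, div_eq_iff (s.den_ne_zero z)] at h3
  simp only [Set.mem_ofPred_eq, Polynomial.IsRoot.def, p, Polynomial.eval_add,
    Polynomial.eval_mul, Polynomial.eval_C, Polynomial.eval_pow, Polynomial.eval_X]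
  linear_combination -h3

/-- A Borel set which meets the orbits of the points with trivial stabilizer, and meets each orbit
in at most one point. -/
theorem exists_measurable_transversal {W : Set SU11} (hW : W ∈ 𝓝 (1 : SU11))
    (hWS : ∀ g ∈ W, g ∈ S → g = 1) : ∃ D : Set 𝔻, MeasurableSet D ∧ IsWandering S D ∧
      ∀ x : 𝔻, (∀ s ∈ S, s • x = x → s = 1 ∨ s = SU11.negOne) → ∃ s ∈ S, s • x ∈ D := by
  let b := TopologicalSpace.countableBasis 𝔻
  -- The empty set is adjoined so that the countable family to be enumerated is certainly nonempty.
  obtain ⟨f, hf⟩ := ((TopologicalSpace.countable_countableBasis 𝔻).mono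
    (Set.sep_subset b (IsWandering S))).insert ∅ |>.exists_eq_range (Set.insert_nonempty _ _)
  have hfo : ∀ n, IsOpen (f n) ∧ IsWandering S (f n) := by
    intro n
    have : f n ∈ insert ∅ {B ∈ b | IsWandering S B} := hf ▸ Set.mem_range_self n
    rcases this with h | h
    · rw [h]; exact ⟨isOpen_empty, fun s _ z hz => hz.elim⟩
    · exact ⟨TopologicalSpace.isOpen_of_mem_countableBasis h.1, h.2⟩
  let O : ℕ → Set 𝔻 := fun n => {z | ∃ s ∈ S, s • z ∈ f n}
  have hO : ∀ n, IsOpen (O n) := by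
    intro n
    have : O n = ⋃ s ∈ S, (fun z : 𝔻 => s • z) ⁻¹' f n := by
      ext z; simp [O]
    rw [this]
    exact isOpen_biUnion fun s _ => (hfo n).1.preimage s.continuous_smul
  -- From each wandering set remove the orbits already met by an earlier one; `O k` is the
  -- saturation of `f k`.
  refine ⟨⋃ n, f n \ ⋃ k < n, O k, ?_, ?_, ?_⟩
  · exact MeasurableSet.iUnion fun n => (hfo n).1.measurableSet.diff
      (isOpen_biUnion fun k _ => hO k).measurableSet
  · rintro s hs z hz hsz
    obtain ⟨n, hzn, hz'⟩ := Set.mem_iUnion.1 hz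
    obtain ⟨k, hsk, hs'⟩ := Set.mem_iUnion.1 hsz
    rcases lt_trichotomy n k with h | rfl | h
    · exact (hs' (Set.mem_iUnion₂.2 ⟨n, h, s⁻¹, S.inv_mem hs, by rwa [inv_smul_smul]⟩)).elim
    · exact (hfo n).2 s hs z hzn hsk
    · exact (hz' (Set.mem_iUnion₂.2 ⟨k, h, s, hs, hsk⟩)).elim
  · intro x hx
    obtain ⟨U, hU, hUw⟩ := exists_isWandering_nhds hW hWS hx
    obtain ⟨B, hB, hxB, hBU⟩ :=
      (TopologicalSpace.isBasis_countableBasis 𝔻).mem_nhds_iff.1 hU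
    have hBf : B ∈ Set.range f := by
      rw [← hf]
      exact Or.inr ⟨hB, fun s hs z hz hsz => hUw s hs z (hBU hz) (hBU hsz)⟩
    obtain ⟨n, rfl⟩ := hBf
    have hex : ∃ n, x ∈ O n := ⟨n, 1, S.one_mem, by rwa [one_smul]⟩
    classical
    obtain ⟨s, hs, hsx⟩ := Nat.find_spec hex
    refine ⟨s, hs, Set.mem_iUnion.2 ⟨Nat.find hex, hsx, fun h => ?_⟩⟩
    obtain ⟨k, hk, t, ht, htx⟩ := Set.mem_iUnion₂.1 h
    refine Nat.find_min hex hk ⟨t * s, S.mul_mem ht hs, ?_⟩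
    rwa [mul_smul]

end Discrete

/-- The unfolded measure is a Haar measure for which the elements carrying 0 into a transversal by
their inverse have finite volume, so the transversal has finite area. The points with nontrivial
stabilizer are added as a countable null set. -/
theorem hasFiniteArea_of_finite_volume {L : Subgroup PSU11} {S : Subgroup SU11}
    (hS : ∀ g, g ∈ S ↔ (QuotientGroup.mk g : PSU11) ∈ L) {W : Set SU11} (hW : W ∈ 𝓝 (1 : SU11))
    (hWS : ∀ g ∈ W, g ∈ S → g = 1) {μ : @Measure (SU11 ⧸ S) (borel (SU11 ⧸ S))}
    (hinv : IsInvariantOn S μ) (h0 : μ Set.univ ≠ 0) (htop : μ Set.univ ≠ ⊤) :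
    Surface.HasFiniteArea L := by
  borelize SU11
  have hd : DiscreteTopology S := discreteTopology_of_nhds hW hWS
  have hc : Countable S := countable_of_Lindelof_of_discrete
  obtain ⟨σ, hσ, hσ'⟩ := exists_measurable_section hW hWS
  have hHaar := isHaarMeasure_unfoldMeasure hW hWS hσ hσ' hinv h0 htop
  obtain ⟨D, hD, hDw, hDx⟩ := exists_measurable_transversal hW hWS
  have hneg : SU11.negOne ∈ S := by
    rw [hS, (QuotientGroup.eq_one_iff SU11.negOne).2 (Subgroup.mem_zpowers _)]
    exact L.one_mem
  have hx : Measurable fun g : SU11 => g⁻¹ • (0 : 𝔻) :=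
    (continuous_inv.smul continuous_const).measurable
  have hle : unfoldMeasure μ σ {g | g⁻¹ • (0 : 𝔻) ∈ D} ≤ (2 : ℕ) * μ Set.univ := by
    classical
    refine unfoldMeasure_le hσ (hx hD) fun g => ?_
    by_cases h : ∃ s : S, g * s ∈ {g | g⁻¹ • (0 : 𝔻) ∈ D}
    · obtain ⟨s, hs⟩ := h
      -- The bound is 2 because `-1` lies in `S` and acts trivially on the disc.
      refine ⟨{s, s * ⟨SU11.negOne, hneg⟩}, Finset.card_le_two, fun t ht => ?_⟩
      have h1 : ((t : SU11)⁻¹ * (s : SU11)) • ((g * s)⁻¹ • (0 : 𝔻)) = (g * t)⁻¹ • (0 : 𝔻) := by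
        rw [smul_smul]; congr 1; group
      have h2 := hDw ((t : SU11)⁻¹ * (s : SU11)) (S.mul_mem (S.inv_mem t.2) s.2) _ hs (by rw [h1]; exact ht)
      rw [Finset.mem_insert, Finset.mem_singleton]
      rcases h2 with h2 | h2
      · exact Or.inl (Subtype.ext (inv_mul_eq_one.1 h2))
      · refine Or.inr (Subtype.ext ?_)
        rw [inv_mul_eq_iff_eq_mul] at h2
        change (t : SU11) = s * SU11.negOne
        rw [h2, mul_assoc, GTilde.negOne_sq, mul_one]
    · exact ⟨∅, by simp, fun s hs => (h ⟨s, hs⟩).elim⟩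
  have hA : hyperbolicArea D < ⊤ := hyperbolicArea_lt_top (unfoldMeasure μ σ) hD
    (hle.trans_lt (ENNReal.mul_lt_top (by simp) htop.lt_top))
  let B : Set 𝔻 := ⋃ s : {s : S // (s : SU11) ≠ 1 ∧ (s : SU11) ≠ SU11.negOne},
    {z | (s : SU11) • z = z}
  have hB : B.Countable := Set.countable_iUnion fun s =>
    (SU11.finite_fixedPoints s.2.1 s.2.2).countable
  have hm := isOpenEmbedding_coe.measurableEmbedding
  refine ⟨((↑) : 𝔻 → ℂ) '' (D ∪ B), hm.measurableSet_image' (hD.union hB.measurableSet), ?_,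
    fun z => ?_, ?_⟩
  · rintro _ ⟨z, -, rfl⟩
    exact UnitDisc.coe_mem_ball z
  · by_cases hz : ∀ s ∈ S, s • z = z → s = 1 ∨ s = SU11.negOne
    · obtain ⟨s, hs, hsz⟩ := hDx z hz
      exact ⟨QuotientGroup.mk s, (hS s).1 hs, _, Or.inl hsz, rfl⟩
    · push Not at hz
      obtain ⟨s, hs, hsz, h1, h2⟩ := hz
      refine ⟨1, L.one_mem, z, Or.inr (Set.mem_iUnion.2 ⟨⟨⟨s, hs⟩, h1, h2⟩, hsz⟩), ?_⟩
      rw [one_smul]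
  · change ∫⁻ z in ((↑) : 𝔻 → ℂ) '' (D ∪ B), areaDensity z < ⊤
    rw [Set.image_union]
    refine (lintegral_union_le _ _ _).trans_lt (ENNReal.add_lt_top.2 ⟨?_, ?_⟩)
    · rwa [← hyperbolicArea_apply hD]
    · rw [setLIntegral_measure_zero _ _ ((hB.image _).measure_zero _)]
      exact ENNReal.zero_lt_top


/-! ### Transitive measures -/

theorem isInducedBy_inducedRoot {M N : ℕ} (hN : 0 < N) (hMN : M.Coprime N) {θ : Hol}
    (hθ : θ ≠ 0) : (inducedRoot hN hMN hθ).IsInducedBy (stab (rhoCover M N) θ) :=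
  fun l _ hg hl z => inducedRoot_factor hN hMN hθ l hg hl z

theorem isPullback_inducedDifferential {M N : ℕ} (hN : 0 < N) (hMN : M.Coprime N) {θ : Hol}
    (hθ : θ ≠ 0) : (inducedDifferential hN hMN hθ).IsPullback θ := fun _ => rfl

/-- The stability subgroup of a nonzero differential with an orbit of finite volume contains a
nontrivial central element, and its image in `PSU(1,1)` is discrete. -/
theorem exists_nhds_stab {m : ℝ} (hm : 0 < m) {θ : Hol} (hθ : θ ≠ 0)
    {μ : @Measure (GTilde ⧸ stab (rho m) θ) (borel (GTilde ⧸ stab (rho m) θ))}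
    (hinv : IsInvariantOn (stab (rho m) θ) μ) (h0 : μ Set.univ ≠ 0) (htop : μ Set.univ ≠ ⊤) :
    (∃ W ∈ 𝓝 (1 : SU11), ∀ g ∈ W,
      (QuotientGroup.mk g : PSU11) ∈ (stab (rho m) θ).map GTilde.toPSU → g = 1) ∧
    ∃ n : ℕ, 0 < n ∧ GTilde.center ^ n ∈ stab (rho m) θ := by
  obtain ⟨F, hF, hθF⟩ := θ.2
  have hne : ∃ z : 𝔻, F z ≠ 0 := by
    obtain ⟨z, hz⟩ := exists_ne_zero_of_ne_zero hθ
    exact ⟨z, by rwa [← hθF]⟩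
  have hS : ∀ g ∈ stab (rho m) θ, g.mat ∈ symmetryGroup (hyperbolicNormSq m F) := fun g hg =>
    mat_mem_symmetryGroup m hθF hg
  obtain ⟨W, hW, hW1⟩ := exists_nhds_inter_symmetryGroup hm hF hne
    (accumulatesAtBoundary_of_isInvariantOn hinv h0 htop hS)
  refine ⟨⟨W, hW, fun g hg hgL => hW1 g hg ?_⟩, exists_center_pow_mem hinv h0 htop hS hW hW1⟩
  obtain ⟨x, hx, hxg⟩ := hgL
  -- The element `g` agrees up to sign with the matrix of a stabilizer element, and `-1` is a
  -- symmetry of every function on the disc.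
  have h1 : x.mat⁻¹ * g ∈ Subgroup.zpowers SU11.negOne := QuotientGroup.eq.1 hxg
  have h2 : x.mat⁻¹ * g ∈ symmetryGroup (hyperbolicNormSq m F) :=
    (Subgroup.zpowers_le.2 (negOne_mem_symmetryGroup _)) h1
  exact (Subgroup.mul_mem_cancel_left _ (inv_mem (hS x hx))).1 h2

theorem map_stab_rhoCover (M N : ℕ) (θ : Hol) :
    (stab (rhoCover M N) θ).map (GCover.toPSU N)
      = (stab (rho ((M : ℝ) / N)) θ).map GTilde.toPSU := by
  ext x
  constructor
  · rintro ⟨y, hy, rfl⟩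
    obtain ⟨g, rfl⟩ := QuotientGroup.mk_surjective y
    exact ⟨g, hy, rfl⟩
  · rintro ⟨g, hg, rfl⟩
    exact ⟨QuotientGroup.mk g, hg, rfl⟩

/-- The same measure is pushed to three quotients: of the `N`-fold cover, of `PSU(1,1)` and of
`SU(1,1)`. Discreteness is known in `PSU(1,1)` and is pulled back to the cover through the
continuous injective projection on the stabilizer. -/
theorem lattices_of_finite_volume {M N : ℕ} (hM : 0 < M) (hN : 0 < N) (hMN : M.Coprime N)
    {θ : Hol} (hθ : θ ≠ 0) {ν : Measure Hol}
    (h : IsNormalizedOrbitVolume (rho ((M : ℝ) / N)) θ ν) :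
    IsLattice (stab (rhoCover M N) θ) ∧
      IsLattice ((stab (rhoCover M N) θ).map (GCover.toPSU N)) ∧
      Surface.HasFiniteArea ((stab (rhoCover M N) θ).map (GCover.toPSU N)) := by
  obtain ⟨μ, hinv, h0, htop, -⟩ := h
  obtain ⟨⟨W, hW, hW1⟩, -⟩ := exists_nhds_stab (by positivity) hθ hinv h0 htop
  rw [← map_stab_rhoCover] at hW1
  set L := (stab (rhoCover M N) θ).map (GCover.toPSU N) with hL
  have hdL : DiscreteTopology L := discreteTopology_of_mk_mem hW hW1
  have hle : ∀ g ∈ stab (rho ((M : ℝ) / N)) θ, g.toPSU ∈ L := fun g hg =>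
    ⟨QuotientGroup.mk g, hg, rfl⟩
  have hcont : Continuous (GCover.toPSU N) :=
    QuotientGroup.isOpenQuotientMap_mk.isQuotientMap.continuous_iff.2 GTilde.continuous_toPSU
  have hdLN : DiscreteTopology (stab (rhoCover M N) θ) := by
    let φ : stab (rhoCover M N) θ → L := fun x => ⟨GCover.toPSU N x, x, x.2, rfl⟩
    refine DiscreteTopology.of_continuous_injective (f := φ)
      ((hcont.comp continuous_subtype_val).subtype_mk _) fun x y hxy => Subtype.ext ?_
    exact injOn_toPSU hN hMN hθ x.2 y.2 (congrArg Subtype.val hxy)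
  let S : Subgroup SU11 := L.comap (QuotientGroup.mk' _)
  have hleS : stab (rho ((M : ℝ) / N)) θ ≤ S.comap GTilde.toSU := hle
  have hsurj : Function.Surjective GTilde.toSU := GTilde.exists_mat_eq
  have hcSU : Continuous GTilde.toSU := GTilde.continuous_mat
  refine ⟨?_, ?_, ?_⟩
  · exact isLattice_of_hom (φ := QuotientGroup.mk' (Subgroup.zpowers (GTilde.center ^ N)))
      QuotientGroup.continuous_mk (QuotientGroup.mk'_surjective _) (fun g hg => hg) hinv h0 htop
      hdLN
  · exact isLattice_of_hom GTilde.continuous_toPSU GTilde.toPSU_surjective hle hinv h0 htop hdL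
  · exact hasFiniteArea_of_finite_volume (S := S) (fun g => Iff.rfl) hW hW1
      (isInvariantOn_pushCoset hcSU hsurj hleS hinv)
      ((pushCoset_univ hcSU hleS μ).trans_ne h0) ((pushCoset_univ hcSU hleS μ).trans_ne htop)

end ConformalDisc

end

/-! ### Classification of the transitive measures. -/

theorem mainTheorem8 (m : ℝ) (hm : 0 < m) (ν : MeasureTheory.Measure ConformalDisc.Hol)
    (hν : ConformalDisc.IsTransitiveMeasure m ν) :
    ν = MeasureTheory.Measure.dirac 0 ∨
    ∃ M N : ℕ, 0 < M ∧ 0 < N ∧ M.Coprime N ∧ m = (M : ℝ) / N ∧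
      ∃ θ : ConformalDisc.Hol, θ ≠ 0 ∧
        ConformalDisc.IsNormalizedOrbitVolume (ConformalDisc.rhoCover M N) θ ν ∧
        ∃ (LN : Subgroup (ConformalDisc.GCover N)) (L : Subgroup ConformalDisc.PSU11),
          LN = ConformalDisc.stab (ConformalDisc.rhoCover M N) θ ∧
          ConformalDisc.IsLattice LN ∧
          L = LN.map (ConformalDisc.GCover.toPSU N) ∧
          Set.InjOn (ConformalDisc.GCover.toPSU N) LN ∧
          ConformalDisc.IsLattice L ∧
          ConformalDisc.Surface.HasFiniteArea L ∧
          ∃ κ : ConformalDisc.CanonicalRoot L N, κ.IsInducedBy LN ∧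
            ∃ s : κ.Differential M, s.IsPullback θ := by
  obtain ⟨θ, hθν⟩ := hν
  by_cases hθ : θ = 0
  · subst hθ
    exact Or.inl (ConformalDisc.eq_dirac_of_isNormalizedOrbitVolume_zero hθν)
  have hθν' := hθν
  obtain ⟨μ, hinv, h0, htop, -⟩ := hθν'
  obtain ⟨-, n, hn, hmem⟩ := ConformalDisc.exists_nhds_stab hm hθ hinv h0 htop
  obtain ⟨l, hl⟩ := ConformalDisc.exists_int_of_center_pow_mem hθ hmem
  obtain ⟨M, N, hM, hN, hMN, rfl⟩ := ConformalDisc.exists_coprime_of_mul_eq_int hm hn hl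
  obtain ⟨h1, h2, h3⟩ := ConformalDisc.lattices_of_finite_volume hM hN hMN hθ hθν
  exact Or.inr ⟨M, N, hM, hN, hMN, rfl, θ, hθ,
    ConformalDisc.isNormalizedOrbitVolume_rhoCover hθν, _, _, rfl, h1, rfl,
    ConformalDisc.injOn_toPSU hN hMN hθ, h2, h3,
    ConformalDisc.inducedRoot hN hMN hθ, ConformalDisc.isInducedBy_inducedRoot hN hMN hθ, ConformalDisc.inducedDifferential hN hMN hθ,
    ConformalDisc.isPullback_inducedDifferential hN hMN hθ⟩
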